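/- Let $T$ be a tree with $n\ge 1$ nodes $V$, rooted at a node $r$ (the depot). Every edge has a length $\ell\ge 0$, which is the cost of traversing it back and forth; every node $v$ has a prize $p_v\in\mathbb R$ and a probability $\pi_v\in(0,1]$. (Customers have $p_v>0$; a node that is only a bifurcation of the network is given $p_v=-1$ and $\pi_v=1$.) The nodes issue requests independently, $v$ with probability $\pi_v$, so that the set of requesting nodes equals $\omega\subseteq V$ with probability $\mathbb P(\omega)=\prod_{v\in\omega}\pi_v\prod_{v\notin\omega}(1-\pi_v)$. If $S\subseteq V$ is selected in advance, the profit in the outcome $\omega$ is $$G_\omega(S,0)=\sum_{v\in S\cap\omega}p_v-C_\omega(S,0),$$ where $C_\omega(S,0)$, the cost of a cheapest tour from the depot through $S\cap\omega$, is the total length of the edges that lie on the path from $r$ to some node of $S\cap\omega$. The probabilistic profitable tour problem on a tree (PPTP-T) asks for a set $S\subseteq V$ that maximizes the expected profit $\mathbb E[G(S,0)]=\sum_{\omega\subseteq V}G_\omega(S,0)\,\mathbb P(\omega)$. Theorem. PPTP-T can be solved in $O(n^2)$ time: there are a program for the unit-cost real random access machine (exact arithmetic operations and comparisons on real numbers,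 additions, subtractions and comparisons of indices, and array accesses, each at unit cost) and a constant $C$ such that, for every $n\ge 1$ and every instance with $n$ nodes, given by its root and the arrays of parents, edge lengths, prizes and probabilities, the program halts after at most $Cn^2$ steps and outputs a set $S\subseteq V$ with $\mathbb E[G(S,0)]=\max_{S'\subseteq V}\mathbb E[G(S',0)]$. -/

import Mathlib

/-! Part 1: a unit-cost real RAM with structured control flow. -/

namespace RealRAM

/-- Expressions of natural-number (index) type. The machine has index registers and arrays of
natural numbers, both named by literals of the program. Subtraction is truncated at `0`;
there is no multiplication of indices and no conversion from reals to indices. -/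
inductive NatExpr : Type
  | const (c : ℕ)
  | reg (r : ℕ)
  | get (a : ℕ) (i : NatExpr)
  | add (e f : NatExpr)
  | sub (e f : NatExpr)

/-- Expressions of real type: natural-number literals, real registers, entries of real arrays,
and the four exact arithmetic operations (a division by zero returns `0`). -/
inductive RealExpr : Type
  | const (c : ℕ)
  | reg (r : ℕ)
  | get (a : ℕ) (i : NatExpr)
  | add (e f : RealExpr)
  | sub (e f : RealExpr)
  | mul (e f : RealExpr)
  | div (e f : RealExpr)

/-- Tests: comparisons of indices, exact comparisons of reals, Boolean combinations. -/
inductive Test : Type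
  | natEq (e f : NatExpr)
  | natLt (e f : NatExpr)
  | realLt (e f : RealExpr)
  | neg (b : Test)
  | and (b c : Test)

/-- Programs. A program is a finite object, so it names finitely many registers and arrays. -/
inductive Prog : Type
  | skip
  | setNat (r : ℕ) (e : NatExpr)
  | setReal (r : ℕ) (e : RealExpr)
  | putNat (a : ℕ) (i : NatExpr) (e : NatExpr)
  | putReal (a : ℕ) (i : NatExpr) (e : RealExpr)
  | seq (p q : Prog)
  | ite (b : Test) (p q : Prog)
  | loop (b : Test) (p : Prog)

/-- A memory state: index registers, real registers, arrays of indices, arrays of reals. -/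
@[ext]
structure State : Type where
  natReg : ℕ → ℕ
  realReg : ℕ → ℝ
  natArr : ℕ → ℕ → ℕ
  realArr : ℕ → ℕ → ℝ

namespace NatExpr

/-- Value of an index expression. -/
def eval (s : State) : NatExpr → ℕ
  | const c => c
  | reg r => s.natReg r
  | get a i => s.natArr a (i.eval s)
  | add e f => e.eval s + f.eval s
  | sub e f => e.eval s - f.eval s

/-- Number of unit-cost operations needed to evaluate an index expression. -/
def cost : NatExpr → ℕ
  | const _ => 1
  | reg _ => 1
  | get _ i => i.cost + 1
  | add e f => e.cost + f.cost + 1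
  | sub e f => e.cost + f.cost + 1

end NatExpr

namespace RealExpr

/-- Value of a real expression. -/
noncomputable def eval (s : State) : RealExpr → ℝ
  | const c => (c : ℝ)
  | reg r => s.realReg r
  | get a i => s.realArr a (i.eval s)
  | add e f => e.eval s + f.eval s
  | sub e f => e.eval s - f.eval s
  | mul e f => e.eval s * f.eval s
  | div e f => e.eval s / f.eval s

/-- Number of unit-cost operations needed to evaluate a real expression. -/
def cost : RealExpr → ℕ
  | const _ => 1
  | reg _ => 1
  | get _ i => i.cost + 1
  | add e f => e.cost + f.cost + 1
  | sub e f => e.cost + f.cost + 1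
  | mul e f => e.cost + f.cost + 1
  | div e f => e.cost + f.cost + 1

end RealExpr

namespace Test

/-- Truth of a test in a state. -/
def Holds (s : State) : Test → Prop
  | natEq e f => e.eval s = f.eval s
  | natLt e f => e.eval s < f.eval s
  | realLt e f => e.eval s < f.eval s
  | neg b => ¬ b.Holds s
  | and b c => b.Holds s ∧ c.Holds s

/-- Number of unit-cost operations needed to evaluate a test. -/
def cost : Test → ℕ
  | natEq e f => e.cost + f.cost + 1
  | natLt e f => e.cost + f.cost + 1
  | realLt e f => e.cost + f.cost + 1
  | neg b => b.cost + 1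
  | and b c => b.cost + c.cost + 1

end Test

namespace State

/-- Write `x` into index register `r`. -/
def setNat (s : State) (r : ℕ) (x : ℕ) : State :=
  { s with natReg := Function.update s.natReg r x }

/-- Write `x` into real register `r`. -/
def setReal (s : State) (r : ℕ) (x : ℝ) : State :=
  { s with realReg := Function.update s.realReg r x }

/-- Write `x` into cell `i` of the index array `a`. -/
def putNat (s : State) (a i : ℕ) (x : ℕ) : State :=
  { s with natArr := Function.update s.natArr a (Function.update (s.natArr a) i x) }

/-- Write `x` into cell `i` of the real array `a`. -/
def putReal (s : State) (a i : ℕ) (x : ℝ) : State :=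
  { s with realArr := Function.update s.realArr a (Function.update (s.realArr a) i x) }

end State

/-- `Exec p s s₁ t`: the program `p`, started in the state `s`, halts in the state `s₁` after
exactly `t` unit-cost steps. A program that does not halt has no execution. -/
inductive Exec : Prog → State → State → ℕ → Prop
  | skip (s : State) : Exec Prog.skip s s 1
  | setNat (s : State) (r : ℕ) (e : NatExpr) :
      Exec (Prog.setNat r e) s (s.setNat r (e.eval s)) (e.cost + 1)
  | setReal (s : State) (r : ℕ) (e : RealExpr) :
      Exec (Prog.setReal r e) s (s.setReal r (e.eval s)) (e.cost + 1)
  | putNat (s : State) (a : ℕ) (i e : NatExpr) :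
      Exec (Prog.putNat a i e) s (s.putNat a (i.eval s) (e.eval s)) (i.cost + e.cost + 1)
  | putReal (s : State) (a : ℕ) (i : NatExpr) (e : RealExpr) :
      Exec (Prog.putReal a i e) s (s.putReal a (i.eval s) (e.eval s)) (i.cost + e.cost + 1)
  | seq {p q : Prog} {s s₁ s₂ : State} {t₁ t₂ : ℕ} (h₁ : Exec p s s₁ t₁)
      (h₂ : Exec q s₁ s₂ t₂) : Exec (Prog.seq p q) s s₂ (t₁ + t₂)
  | iteTrue {b : Test} {p q : Prog} {s s₁ : State} {t : ℕ} (hb : b.Holds s)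
      (h : Exec p s s₁ t) : Exec (Prog.ite b p q) s s₁ (b.cost + t + 1)
  | iteFalse {b : Test} {p q : Prog} {s s₁ : State} {t : ℕ} (hb : ¬ b.Holds s)
      (h : Exec q s s₁ t) : Exec (Prog.ite b p q) s s₁ (b.cost + t + 1)
  | loopTrue {b : Test} {p : Prog} {s s₁ s₂ : State} {t₁ t₂ : ℕ} (hb : b.Holds s)
      (h₁ : Exec p s s₁ t₁) (h₂ : Exec (Prog.loop b p) s₁ s₂ t₂) :
      Exec (Prog.loop b p) s s₂ (b.cost + t₁ + t₂ + 1)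
  | loopFalse {b : Test} {p : Prog} {s : State} (hb : ¬ b.Holds s) :
      Exec (Prog.loop b p) s s (b.cost + 1)

end RealRAM

/-! Part 2: the probabilistic profitable tour problem on a rooted weighted tree. -/

/-- An instance with `n` nodes: a rooted tree given by parent pointers (the root points to
itself, and every node reaches the root), the length `len v ≥ 0` (cost of both directions) of the
edge from `v ≠ root` to its parent, the prize and the request probability of every node. Prizes
are arbitrary reals: customers have a positive prize, and a node that is a mere bifurcation of the
network is given prize `-1` and probability `1`. -/
structure PPTPT (n : ℕ) : Type where
  root : Fin n
  parent : Fin n → Fin n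
  parent_root : parent root = root
  reaches_root : ∀ v, ∃ k : ℕ, parent^[k] v = root
  len : Fin n → ℝ
  len_nonneg : ∀ v, v ≠ root → 0 ≤ len v
  prize : Fin n → ℝ
  prob : Fin n → ℝ
  prob_pos : ∀ v, 0 < prob v
  prob_le_one : ∀ v, prob v ≤ 1

namespace PPTPT

variable {n : ℕ}

open scoped Classical in
/-- Node set of the sub-tree rooted at `v`: the nodes whose path to the root meets `v`. -/
noncomputable def subtree (T : PPTPT n) (v : Fin n) : Finset (Fin n) :=
  Finset.univ.filter fun u => ∃ k : ℕ, T.parent^[k] u = v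

/-- Cost to reach `v` from the root: total length of the edges on the path between them. -/
noncomputable def dist (T : PPTPT n) (v : Fin n) : ℝ :=
  ∑ u ∈ Finset.univ.filter (fun u => u ≠ T.root ∧ v ∈ T.subtree u), T.len u

/-- Probability that exactly the nodes of `ω` issue a request. -/
noncomputable def outcomeProb (T : PPTPT n) (ω : Finset (Fin n)) : ℝ :=
  (∏ v ∈ ω, T.prob v) * ∏ v ∈ ωᶜ, (1 - T.prob v)

/-- Expected value of a random variable on the space of outcomes. -/
noncomputable def expectation (T : PPTPT n) (X : Finset (Fin n) → ℝ) : ℝ :=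
  ∑ ω : Finset (Fin n), X ω * T.outcomeProb ω

/-- `1` if some node of `Q` issues a request in the outcome `ω`, and `0` otherwise. -/
noncomputable def indicator (Q ω : Finset (Fin n)) : ℝ :=
  if (Q ∩ ω).Nonempty then 1 else 0

/-- Revenue of the selection `S` in the outcome `ω`. -/
noncomputable def revenue (T : PPTPT n) (S ω : Finset (Fin n)) : ℝ :=
  ∑ s ∈ S, T.prize s * indicator {s} ω

/-- Cost, from the node `a` on, of visiting the nodes of `S ∩ ω` in the sub-tree of `a`: the edge
above a node `u` strictly below `a` is paid exactly when the sub-tree of `u` meets `S ∩ ω`. -/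
noncomputable def costFrom (T : PPTPT n) (a : Fin n) (S ω : Finset (Fin n)) : ℝ :=
  ∑ u ∈ (T.subtree a).erase a, T.len u * indicator (S ∩ T.subtree u) ω

/-- Cost `C(S, x)` with bonus `x` of a selection `S` contained in the sub-tree of `a`. -/
noncomputable def discountedCost (T : PPTPT n) (a : Fin n) (S : Finset (Fin n)) (x : ℝ)
    (ω : Finset (Fin n)) : ℝ :=
  (T.dist a - x + T.costFrom a S ω) * indicator S ω

/-- Profit `G(S, x)` with bonus `x` of a selection `S` of nodes of the whole tree. -/
noncomputable def profit (T : PPTPT n) (S : Finset (Fin n)) (x : ℝ) (ω : Finset (Fin n)) : ℝ :=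
  T.revenue S ω - T.discountedCost T.root S x ω

/-- `S` maximizes the expected profit without bonus. -/
def IsOptimalSet (T : PPTPT n) (S : Finset (Fin n)) : Prop :=
  ∀ S₁ : Finset (Fin n), T.expectation (T.profit S₁ 0) ≤ T.expectation (T.profit S 0)

/-- The first `n` cells of an array hold the values of `f`, all other cells hold `0`. -/
def toArray {α : Type} [Zero α] (f : Fin n → α) (i : ℕ) : α :=
  if h : i < n then f ⟨i, h⟩ else 0

/-- Initial memory: index registers `0`, `1` hold the number of nodes and the root; index array `0`
holds the parents; real arrays `0`, `1`, `2` hold edge lengths, prizes and probabilities. All the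
rest is zero. -/
noncomputable def input (T : PPTPT n) : RealRAM.State where
  natReg := fun r => if r = 0 then n else if r = 1 then (T.root : ℕ) else 0
  realReg := fun _ => 0
  natArr := fun a => if a = 0 then toArray (fun v => (T.parent v : ℕ)) else fun _ => 0
  realArr := fun a =>
    if a = 0 then toArray T.len
    else if a = 1 then toArray T.prize
    else if a = 2 then toArray T.prob
    else fun _ => 0

/-- The node set read off a final memory: `v` is selected when cell `v` of index array `1`
holds `1`. -/
def output (n : ℕ) (s : RealRAM.State) : Finset (Fin n) :=
  Finset.univ.filter fun v => s.natArr 1 (v : ℕ) = 1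

end PPTPT

/-! Lists of blocks and their optimal prefixes. -/

/-! A sub-tree interacts with the rest of the tree only through the penalty `z` that falls due as
soon as one of its selected nodes issues a request. For each selection the expected gain is affine
in `z`, with slope minus the probability of a request. It turns out that the optimal selections for
all `z ≥ 0` can be taken from one increasing chain, stored as the prefixes of a list of blocks. This
is `Represents`: the gain of each prefix is its `total`, and no other selection exceeds `best`.

Three operations build these lists from the leaves to the root. Pooling: if `a.price * a.idle ≤
b.price` for consecutive blocks, then `b` pays whenever `a` does, so no optimum has to stop between
them (`best_pool`). Pooling as long as possible makes the list `Ironed`. Charging: the edge above a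
sub-tree is paid exactly when the sub-tree has a selected request, so it replaces `z` by `z + len`.
On an ironed list this lowers each price by the length times the preceding idle probabilities, and
everything from the first negative price on can be cut (`best_shift`). Merging: independent blocks
can be charged in any order (`total_cons_identity`), and an exchange argument shows that merging two
lists by decreasing prices is optimal (`Merge.total_add_total_le`, `Represents.merge`). At the root
the penalty is `0` and all prices are nonnegative, so the whole list is optimal
(`isOptimalSet_union`).

The blocks of a list have distinct nodes as representatives, so a list has at most `n` of them.
Finding a node whose children are done, ironing, charging and merging are then linear in `n`, and
there are `n - 1` such rounds (`round_within`, `rounds_within`). A pool only redirects one pointer;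
at the end each node follows `n` pointers to find its block, which is again quadratic in total
(`solve_within`). `Frame` and `Stores` express that work on one list leaves the others intact. -/

/-- A set of nodes that are selected together: `idle` is the probability that none of them issues a
request, and `price * (1 - idle)` is the expected profit that they add. -/
@[ext]
structure Block (n : ℕ) : Type where
  price : ℝ
  idle : ℝ
  nodes : Finset (Fin n)

namespace Block

variable {n : ℕ}

/-- Expected profit of all blocks of a list when a penalty `z` is paid as soon as one node issues a
request. -/
noncomputable def total : List (Block n) → ℝ → ℝ
  | [], _ => 0
  | b :: L, z => (b.price - z) * (1 - b.idle) + total L (z * b.idle)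

/-- Largest value of `total` over the prefixes of a list. -/
noncomputable def best : List (Block n) → ℝ → ℝ
  | [], _ => 0
  | b :: L, z => max 0 ((b.price - z) * (1 - b.idle) + best L (z * b.idle))

/-- Probability that no node of a list of independent blocks issues a request. -/
noncomputable def idleProd (L : List (Block n)) : ℝ := (L.map idle).prod

/-- Union of the blocks of a list. -/
def union : List (Block n) → Finset (Fin n)
  | [] => ∅
  | b :: L => b.nodes ∪ union L

/-- The probability that the block stays idle is meaningful and the block is not always idle. -/
def Valid (b : Block n) : Prop := 0 ≤ b.idle ∧ b.idle < 1

/-- The union of two consecutive blocks. -/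
noncomputable def pool (a b : Block n) : Block n where
  price := (a.price * (1 - a.idle) + b.price * (1 - b.idle)) / (1 - a.idle * b.idle)
  idle := a.idle * b.idle
  nodes := a.nodes ∪ b.nodes

/-- The penalties at which the blocks of the list become worthwhile decrease. -/
def Ironed (L : List (Block n)) : Prop := L.IsChain fun a b => b.price ≤ a.price * a.idle

/-- Charge the additional penalty `x`, and cut the list at the first block of negative price. -/
noncomputable def shift : ℝ → List (Block n) → List (Block n)
  | _, [] => []
  | x, b :: L =>
    if b.price < x then [] else ⟨b.price - x, b.idle, b.nodes⟩ :: shift (x * b.idle) L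

/-- `M` is a merge of `A` and `B` by decreasing prices. -/
inductive Merge : List (Block n) → List (Block n) → List (Block n) → Prop
  | nil : Merge [] [] []
  | left {A B M : List (Block n)} (a : Block n) (h : Merge A B M)
      (ha : ∀ b ∈ B, b.price ≤ a.price) : Merge (a :: A) B (a :: M)
  | right {A B M : List (Block n)} (b : Block n) (h : Merge A B M)
      (hb : ∀ a ∈ A, a.price ≤ b.price) : Merge A (b :: B) (b :: M)

@[simp] theorem idleProd_nil : idleProd ([] : List (Block n)) = 1 := rfl

@[simp] theorem idleProd_cons (b : Block n) (L : List (Block n)) :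
    idleProd (b :: L) = b.idle * idleProd L := by simp [idleProd]

/-- The partial products of idle probabilities telescope, so `z` is charged with the probability
that some block is active. The slope in `z` thus determines `idleProd`, which
`Represents.idle_union` exploits. -/
theorem total_eq (L : List (Block n)) (z : ℝ) : total L z = total L 0 - z * (1 - idleProd L) := by
  induction L generalizing z with
  | nil => simp [total]
  | cons b L ih =>
    simp only [total, idleProd_cons]
    rw [ih (z * b.idle), ih (0 * b.idle)]
    ring

theorem best_nonneg (L : List (Block n)) (z : ℝ) : 0 ≤ best L z := by
  cases L <;> simp [best]

theorem exists_prefix_best (L : List (Block n)) (z : ℝ) : ∃ P, P <+: L ∧ best L z = total P z := by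
  induction L generalizing z with
  | nil => exact ⟨[], List.prefix_refl _, rfl⟩
  | cons b L ih =>
    obtain ⟨P, hP, h⟩ := ih (z * b.idle)
    rcases le_total ((b.price - z) * (1 - b.idle) + best L (z * b.idle)) 0 with h0 | h0
    · exact ⟨[], List.nil_prefix, by simp [best, total, h0]⟩
    · exact ⟨b :: P, List.cons_prefix_cons.2 ⟨rfl, hP⟩, by simp [best, total, ← h, h0]⟩

/-- The penalty that reaches the tail is `z` times nonnegative idle probabilities, so comparing the
tails at nonnegative penalties is enough. This carries `best_pool` into the interior of a list. -/
theorem best_append_mono (X : List (Block n)) {Y Z : List (Block n)}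
    (h : ∀ z, 0 ≤ z → best Y z ≤ best Z z) (hX : ∀ b ∈ X, b.Valid) {z : ℝ} (hz : 0 ≤ z) :
    best (X ++ Y) z ≤ best (X ++ Z) z := by
  induction X generalizing z with
  | nil => exact h z hz
  | cons b X ih =>
    have hb := hX b (by simp)
    have := ih (fun c hc => hX c (by simp [hc])) (mul_nonneg hz hb.1)
    simp only [List.cons_append, best]
    gcongr

theorem mem_union {L : List (Block n)} {v : Fin n} : v ∈ union L ↔ ∃ b ∈ L, v ∈ b.nodes := by
  induction L with
  | nil => simp [union]
  | cons b X ih => simp [union, ih]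

/-! ### Pooling two consecutive blocks -/

/-- The division in `pool` preserves the sum of the values `price * (1 - idle)`, and `1 - a b = (1 -
a) + a (1 - b)` splits the penalty. Validity keeps the denominator away from zero. -/
theorem pool_identity {a b : Block n} (ha : a.Valid) (hb : b.Valid) (z : ℝ) :
    ((pool a b).price - z) * (1 - (pool a b).idle) =
      (a.price - z) * (1 - a.idle) + (b.price - z * a.idle) * (1 - b.idle) := by
  have h : (1 - a.idle * b.idle) ≠ 0 := by nlinarith [ha.1, ha.2, hb.1, hb.2]
  simp only [pool]
  rw [sub_mul, div_mul_cancel₀ _ h]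
  ring

theorem Valid.pool {a b : Block n} (ha : a.Valid) (hb : b.Valid) : (pool a b).Valid :=
  ⟨mul_nonneg ha.1 hb.1, by simp only [Block.pool]; nlinarith [ha.1, ha.2, hb.1, hb.2]⟩

theorem total_pool {a b : Block n} (ha : a.Valid) (hb : b.Valid) (L : List (Block n)) (z : ℝ) :
    total (pool a b :: L) z = total (a :: b :: L) z := by
  have := pool_identity ha hb z
  simp only [total, this, add_assoc]
  simp [pool, mul_assoc]

/-- If continuing after `a` does not pay, then `b.price ≤ z * a.idle`, hence `a.price ≤ z` by `h`,
and stopping before `a` is no worse. So the cut between `a` and `b` is dispensable. -/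
theorem best_pool {a b : Block n} (ha : a.Valid) (hb : b.Valid)
    (h : a.price * a.idle ≤ b.price) (L : List (Block n)) (z : ℝ) :
    best (a :: b :: L) z ≤ best (pool a b :: L) z := by
  have hp := pool_identity ha hb z
  have hi : z * (pool a b).idle = z * a.idle * b.idle := by simp [pool, mul_assoc]
  have hL := best_nonneg L (z * a.idle * b.idle)
  simp only [best, hp, hi]
  rw [mul_assoc] at *
  apply max_le (le_max_left _ _)
  rcases le_total 0 ((b.price - z * a.idle) * (1 - b.idle) + best L (z * (a.idle * b.idle)))
    with h0 | h0
  · rw [max_eq_right h0]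
    exact le_max_of_le_right (by linarith)
  · rw [max_eq_left h0, add_zero]
    have h1 : (b.price - z * a.idle) * (1 - b.idle) ≤ 0 := by linarith
    have h2 : b.price ≤ z * a.idle := by
      by_contra hc
      push Not at hc
      have := mul_pos (sub_pos.2 hc) (sub_pos.2 hb.2)
      linarith
    -- Cancelling `a.idle` requires it to be positive. If it is zero, `h` and `h2` force `b.price =
    -- 0`, and adding `b` costs nothing.
    rcases eq_or_lt_of_le ha.1 with h3 | h3
    · have h4 : (b.price - z * a.idle) * (1 - b.idle) = 0 := by
        have : b.price = z * a.idle := le_antisymm h2 (by rw [← h3] at h ⊢; linarith)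
        rw [this]; ring
      exact le_max_of_le_right (by linarith)
    · have : a.price ≤ z := le_of_mul_le_mul_right (h.trans h2) h3
      exact le_max_of_le_left (mul_nonpos_of_nonpos_of_nonneg (by linarith) (by linarith [ha.2]))

theorem pool_price_nonneg {a b : Block n} (ha : a.Valid) (hb : b.Valid) (h : 0 ≤ a.price)
    (h' : 0 ≤ b.price) : 0 ≤ (pool a b).price := by
  have h1 : 0 < (1 - a.idle * b.idle) := by nlinarith [ha.1, ha.2, hb.1, hb.2]
  have := ha.2
  have := hb.2
  exact div_nonneg (add_nonneg (mul_nonneg h (by linarith)) (mul_nonneg h' (by linarith))) h1.le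

/-- Pooling only removes a cut point: opening the pooled block gives the corresponding prefix of the
old list. -/
theorem exists_prefix_pool {a b : Block n} (ha : a.Valid) (hb : b.Valid) {X Y P : List (Block n)}
    (hP : P <+: X ++ pool a b :: Y) :
    ∃ Q, Q <+: X ++ a :: b :: Y ∧ union Q = union P ∧ ∀ z, total Q z = total P z := by
  induction X generalizing P with
  | nil =>
    rcases P with _ | ⟨c, P⟩
    · exact ⟨[], List.nil_prefix, rfl, fun _ => rfl⟩
    · simp only [List.nil_append, List.cons_prefix_cons] at hP
      obtain ⟨rfl, hP⟩ := hP
      refine ⟨a :: b :: P, by simpa using hP, by simp [union, pool, Finset.union_assoc], fun z => ?_⟩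
      exact (total_pool ha hb P z).symm
  | cons x X ih =>
    rcases P with _ | ⟨c, P⟩
    · exact ⟨[], List.nil_prefix, rfl, fun _ => rfl⟩
    · simp only [List.cons_append, List.cons_prefix_cons] at hP
      obtain ⟨rfl, hP⟩ := hP
      obtain ⟨Q, h1, h2, h3⟩ := ih hP
      exact ⟨c :: Q, by simpa using h1, by simp [union, h2], fun z => by simp [total, h3]⟩

/-! ### Charging an additional penalty -/

/-- Ironing passes the inequality between price and penalty to the next block, `b.price ≤ a.price *
a.idle ≤ z * a.idle`, so every term is nonpositive. -/
theorem best_le_zero_of_ironed {L : List (Block n)} (hL : Ironed L) (hv : ∀ b ∈ L, b.Valid) {z : ℝ}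
    (h : ∀ b, L.head? = some b → b.price ≤ z) : best L z ≤ 0 := by
  induction L generalizing z with
  | nil => simp [best]
  | cons a L ih =>
    have ha := hv a (by simp)
    have h1 : a.price ≤ z := h a rfl
    have h2 : best L (z * a.idle) ≤ 0 := by
      apply ih (List.IsChain.tail hL) (fun b hb => hv b (by simp [hb]))
      intro b hb
      rcases L with _ | ⟨c, L⟩
      · simp at hb
      · simp only [List.head?_cons, Option.some.injEq] at hb
        subst hb
        exact (List.isChain_cons_cons.1 hL).1.trans (mul_le_mul_of_nonneg_right h1 ha.1)
    simp only [best]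
    exact max_le le_rfl (add_nonpos
      (mul_nonpos_of_nonpos_of_nonneg (by linarith) (by linarith [ha.2])) h2)

/-- Up to the cut, lowering the prices only regroups the terms. At the cut the price is below `x ≤ z
+ x`, and `best_le_zero_of_ironed` makes the whole rest worthless. -/
theorem best_shift {L : List (Block n)} (hL : Ironed L) (hv : ∀ b ∈ L, b.Valid) {x z : ℝ}
    (hz : 0 ≤ z) : best L (z + x) ≤ best (shift x L) z := by
  induction L generalizing x z with
  | nil => simp [best, shift]
  | cons a L ih =>
    have ha := hv a (by simp)
    simp only [shift]
    split_ifs with h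
    · apply best_le_zero_of_ironed hL hv
      simp only [List.head?_cons, Option.some.injEq, forall_eq']
      linarith
    · have := ih (List.IsChain.tail hL) (fun b hb => hv b (by simp [hb])) (x := x * a.idle)
        (mul_nonneg hz ha.1)
      simp only [best]
      rw [add_mul]
      have e : a.price - x - z = a.price - (z + x) := by ring
      rw [e]
      gcongr

theorem shift_spec {L : List (Block n)} (x : ℝ) {b : Block n} (hb : b ∈ shift x L) :
    0 ≤ b.price ∧ ∃ c ∈ L, c.idle = b.idle ∧ c.nodes = b.nodes := by
  induction L generalizing x with
  | nil => simp [shift] at hb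
  | cons a L ih =>
    simp only [shift] at hb
    split_ifs at hb with h
    · simp at hb
    · rcases List.mem_cons.1 hb with rfl | hb
      · exact ⟨by simpa using h, a, by simp⟩
      · obtain ⟨h1, c, h2, h3⟩ := ih _ hb
        exact ⟨h1, c, by simp [h2], h3⟩

theorem exists_prefix_shift {L P : List (Block n)} {x : ℝ} (hP : P <+: shift x L) :
    ∃ Q, Q <+: L ∧ union Q = union P ∧ ∀ z, total Q (z + x) = total P z := by
  induction L generalizing x P with
  | nil =>
    simp only [shift, List.prefix_nil] at hP
    subst hP
    exact ⟨[], List.nil_prefix, rfl, fun _ => rfl⟩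
  | cons a L ih =>
    rcases P with _ | ⟨c, P⟩
    · exact ⟨[], List.nil_prefix, rfl, fun _ => rfl⟩
    simp only [shift] at hP
    split_ifs at hP with h
    · simp at hP
    · rw [List.cons_prefix_cons] at hP
      obtain ⟨rfl, hP⟩ := hP
      obtain ⟨Q, h1, h2, h3⟩ := ih hP
      refine ⟨a :: Q, by simpa using h1, by simp [union, h2], fun z => ?_⟩
      simp only [total]
      rw [add_mul, h3]
      ring

/-- Ironing gives `b.price - x * a.idle ≤ (a.price - x) * a.idle`. The right side is at most
`a.price - x`, because a price that survives the cut is nonnegative. So a charged list is sorted and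
ready to be merged. -/
theorem shift_isChain {L : List (Block n)} (hL : Ironed L) (hv : ∀ b ∈ L, b.Valid) (x : ℝ) :
    (shift x L).IsChain fun a b => b.price ≤ a.price := by
  induction L generalizing x with
  | nil => simp [shift]
  | cons a L ih =>
    have ha := hv a (by simp)
    have := ih (List.IsChain.tail hL) (fun b hb => hv b (by simp [hb])) (x * a.idle)
    simp only [shift]
    split_ifs with h
    · simp
    · rcases L with _ | ⟨c, L⟩
      · simp [shift]
      · simp only [shift] at this ⊢
        split_ifs at this ⊢ with h'
        · simp
        · refine List.isChain_cons_cons.2 ⟨?_, this⟩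
          have h1 := (List.isChain_cons_cons.1 hL).1
          simp only
          nlinarith [ha.1, ha.2]

theorem shift_pairwise {L : List (Block n)} (hL : Ironed L) (hv : ∀ b ∈ L, b.Valid) (x : ℝ) :
    (shift x L).Pairwise fun a b => b.price ≤ a.price := by
  have : IsTrans (Block n) fun a b => b.price ≤ a.price := ⟨fun a b c h h' => h'.trans h⟩
  exact List.isChain_iff_pairwise.1 (shift_isChain hL hv x)

/-! ### Merging by decreasing prices -/

theorem idleProd_nonneg {L : List (Block n)} (hv : ∀ b ∈ L, b.Valid) : 0 ≤ idleProd L := by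
  apply List.prod_nonneg
  simp only [List.mem_map, forall_exists_index, and_imp, forall_apply_eq_imp_iff₂]
  exact fun b hb => (hv b hb).1

theorem idleProd_le_one {L : List (Block n)} (hv : ∀ b ∈ L, b.Valid) : idleProd L ≤ 1 := by
  induction L with
  | nil => simp
  | cons a L ih =>
    have ha := hv a (by simp)
    have hL : ∀ b ∈ L, b.Valid := fun b hb => hv b (by simp [hb])
    rw [idleProd_cons]
    exact mul_le_one₀ ha.2.le (idleProd_nonneg hL) (ih hL)

/-- Every block of `L` faces a penalty of at least `z * idleProd L`, hence at least its price. -/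
theorem total_nonpos {L : List (Block n)} (hv : ∀ b ∈ L, b.Valid) {c z : ℝ} (hz : 0 ≤ z)
    (h : ∀ b ∈ L, b.price ≤ c) (hc : c ≤ z * idleProd L) : total L z ≤ 0 := by
  induction L generalizing z with
  | nil => simp [total]
  | cons a L ih =>
    have ha := hv a (by simp)
    have hL : ∀ b ∈ L, b.Valid := fun b hb => hv b (by simp [hb])
    rw [idleProd_cons, ← mul_assoc] at hc
    have h1 := ih hL (mul_nonneg hz ha.1) (fun b hb => h b (by simp [hb])) hc
    have h2 : z * a.idle * idleProd L ≤ z := by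
      have := mul_le_one₀ ha.2.le (idleProd_nonneg hL) (idleProd_le_one hL)
      rw [mul_assoc]
      exact mul_le_of_le_one_right hz this
    have h3 := h a (by simp)
    exact add_nonpos (mul_nonpos_of_nonpos_of_nonneg (by linarith) (by linarith [ha.2])) h1

/-- The order of independent blocks does not matter: a block may also be charged last. -/
theorem total_cons_identity (a : Block n) (L : List (Block n)) (z : ℝ) :
    total (a :: L) z = total L z + (a.price - z * idleProd L) * (1 - a.idle) := by
  simp only [total]
  rw [total_eq L z, total_eq L (z * a.idle)]
  ring

theorem Merge.mem_iff {A B M : List (Block n)} (h : Merge A B M) (b : Block n) :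
    b ∈ M ↔ b ∈ A ∨ b ∈ B := by
  induction h with
  | nil => simp
  | left a h ha ih => simp [ih, or_assoc]
  | right a h ha ih => simp only [List.mem_cons, ih]; tauto

/-- An exchange argument along the merge. If the head `a` of `M` is in the chosen prefixes, it is
charged first. If it is missing, then only blocks of the other list are chosen, none dearer than
`a`: either they are worthless, or adding `a` does not hurt. -/
theorem Merge.total_add_total_le {A B M : List (Block n)} (h : Merge A B M)
    (hA : ∀ b ∈ A, b.Valid) (hB : ∀ b ∈ B, b.Valid) {P Q : List (Block n)} (hP : P <+: A)
    (hQ : Q <+: B) {z : ℝ} (hz : 0 ≤ z) : total P z + total Q (z * idleProd P) ≤ best M z := by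
  induction h generalizing P Q z with
  | nil =>
    simp only [List.prefix_nil] at hP hQ
    subst hP hQ
    simp [total, best]
  | @left A B M a h ha ih =>
    have hva := hA a (by simp)
    have ih' := @ih (fun b hb => hA b (by simp [hb])) hB
    simp only [best]
    rcases P with _ | ⟨c, P⟩
    · have hvQ : ∀ b ∈ Q, b.Valid := fun b hb => hB b (hQ.subset hb)
      simp only [total, idleProd_nil, mul_one, zero_add]
      -- The threshold is the penalty that `a` would face when charged after `Q`.
      rcases le_total a.price (z * idleProd Q) with h1 | h1
      · exact le_max_of_le_left
          (total_nonpos hvQ hz (fun b hb => ha b (hQ.subset hb)) h1)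
      · refine le_max_of_le_right ?_
        have h2 := total_cons_identity a Q z
        have h3 := ih' (P := []) List.nil_prefix hQ (mul_nonneg hz hva.1)
        simp only [total, idleProd_nil, mul_one, zero_add] at h2 h3
        have h4 := mul_nonneg (sub_nonneg.2 h1) (sub_nonneg.2 hva.2.le)
        linarith
    · rw [List.cons_prefix_cons] at hP
      obtain ⟨rfl, hP⟩ := hP
      have h3 := ih' hP hQ (mul_nonneg hz hva.1)
      refine le_max_of_le_right ?_
      simp only [total, idleProd_cons]
      rw [← mul_assoc]
      linarith
  | @right A B M a h ha ih =>
    have hva := hB a (by simp)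
    have ih' := @ih hA (fun b hb => hB b (by simp [hb]))
    have hvP : ∀ b ∈ P, b.Valid := fun b hb => hA b (hP.subset hb)
    simp only [best]
    rcases Q with _ | ⟨c, Q⟩
    · simp only [total, add_zero]
      rcases le_total a.price (z * idleProd P) with h1 | h1
      · exact le_max_of_le_left
          (total_nonpos hvP hz (fun b hb => ha b (hP.subset hb)) h1)
      · refine le_max_of_le_right ?_
        have h2 := total_cons_identity a P z
        have h3 := ih' (Q := []) hP List.nil_prefix (mul_nonneg hz hva.1)
        simp only [total, add_zero] at h2 h3
        have h4 := mul_nonneg (sub_nonneg.2 h1) (sub_nonneg.2 hva.2.le)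
        linarith
    · rw [List.cons_prefix_cons] at hQ
      obtain ⟨rfl, hQ⟩ := hQ
      have h3 := ih' hP hQ (mul_nonneg hz hva.1)
      -- The block `c` is moved in front of `P`, where the merged list has it.
      have h2 := total_cons_identity c P z
      refine le_max_of_le_right ?_
      simp only [total] at h2 ⊢
      have e : z * idleProd P * c.idle = z * c.idle * idleProd P := by ring
      rw [e]
      linarith

/-- The blocks of a merged prefix are sorted by origin; a block of `B` is moved behind the blocks of
`A` by `total_cons_identity`. -/
theorem Merge.exists_prefix {A B M P : List (Block n)} (h : Merge A B M) (hP : P <+: M) :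
    ∃ Q R, Q <+: A ∧ R <+: B ∧ union P = union Q ∪ union R ∧
      ∀ z, total P z = total Q z + total R (z * idleProd Q) := by
  induction h generalizing P with
  | nil =>
    simp only [List.prefix_nil] at hP
    subst hP
    exact ⟨[], [], List.nil_prefix, List.nil_prefix, by simp [union], by simp [total]⟩
  | @left A B M a h ha ih =>
    rcases P with _ | ⟨c, P⟩
    · exact ⟨[], [], List.nil_prefix, List.nil_prefix, by simp [union], by simp [total]⟩
    rw [List.cons_prefix_cons] at hP
    obtain ⟨rfl, hP⟩ := hP
    obtain ⟨Q, R, h1, h2, h3, h4⟩ := ih hP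
    refine ⟨c :: Q, R, by simpa using h1, h2, by simp [union, h3, Finset.union_assoc], fun z => ?_⟩
    simp only [total, idleProd_cons, h4, mul_assoc]
    ring
  | @right A B M a h ha ih =>
    rcases P with _ | ⟨c, P⟩
    · exact ⟨[], [], List.nil_prefix, List.nil_prefix, by simp [union], by simp [total]⟩
    rw [List.cons_prefix_cons] at hP
    obtain ⟨rfl, hP⟩ := hP
    obtain ⟨Q, R, h1, h2, h3, h4⟩ := ih hP
    refine ⟨Q, c :: R, h1, by simpa using h2, ?_, fun z => ?_⟩
    · simp only [union, h3]
      rw [Finset.union_left_comm]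
    · have h5 := total_cons_identity c Q z
      have e : z * idleProd Q * c.idle = z * c.idle * idleProd Q := by ring
      simp only [total] at h5 ⊢
      rw [h4, e]
      linarith

theorem best_zero {L : List (Block n)} (hv : ∀ b ∈ L, b.Valid) (h : ∀ b ∈ L, 0 ≤ b.price) :
    best L 0 = total L 0 := by
  induction L with
  | nil => rfl
  | cons a L ih =>
    have ha := hv a (by simp)
    have h1 := ih (fun b hb => hv b (by simp [hb])) (fun b hb => h b (by simp [hb]))
    have h2 := best_nonneg L 0
    simp only [best, total, zero_mul, sub_zero]
    rw [h1] at h2 ⊢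
    exact max_eq_right (add_nonneg (mul_nonneg (h a (by simp)) (by linarith [ha.2])) h2)

end Block

/-! Expected profit, and lists of blocks that represent all optimal selections of a forest. -/

namespace PPTPT

variable {n : ℕ}

open Block

/-- Probability that no node of `S` issues a request. -/
noncomputable def idle (T : PPTPT n) (S : Finset (Fin n)) : ℝ := ∏ v ∈ S, (1 - T.prob v)

/-- Expected profit of `S` when the edges above the nodes of `W` have to be paid, and in addition a
penalty `z` as soon as a node of `S` issues a request. -/
noncomputable def gain (T : PPTPT n) (W S : Finset (Fin n)) (z : ℝ) : ℝ :=
  ∑ v ∈ S, T.prize v * T.prob v - ∑ u ∈ W, T.len u * (1 - T.idle (S ∩ T.subtree u))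
    - z * (1 - T.idle S)

/-! ### Expected profit as a sum over nodes and edges -/

theorem expectation_one (T : PPTPT n) : T.expectation (fun _ => 1) = 1 := by
  have := Finset.prod_add (fun v => T.prob v) (fun v => 1 - T.prob v) Finset.univ
  simp only [add_sub_cancel, Finset.prod_const_one, Finset.powerset_univ] at this
  simp only [expectation, one_mul, outcomeProb, Finset.compl_eq_univ_sdiff]
  exact this.symm

/-- In the expansion of `∏ (p + (1 - p))` over all outcomes, replacing `p` by `0` on `Q` removes
exactly the outcomes that meet `Q`. The product then equals the probability that `Q` stays idle. -/
theorem expectation_indicator (T : PPTPT n) (Q : Finset (Fin n)) :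
    T.expectation (indicator Q) = 1 - T.idle Q := by
  classical
  have h1 : T.expectation (fun ω => 1 - indicator Q ω) = T.idle Q := by
    have := Finset.prod_add (fun v => if v ∈ Q then 0 else T.prob v) (fun v => 1 - T.prob v)
      Finset.univ
    have h2 : ∏ v, ((if v ∈ Q then 0 else T.prob v) + (1 - T.prob v)) = T.idle Q := by
      rw [idle, ← Finset.prod_subset (Finset.subset_univ Q)]
      · refine Finset.prod_congr rfl fun v hv => by simp [hv]
      · intro v _ hv
        simp [hv]
    rw [h2, Finset.powerset_univ] at this
    rw [this, expectation]
    refine Finset.sum_congr rfl fun ω _ => ?_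
    simp only [outcomeProb, Finset.compl_eq_univ_sdiff, indicator]
    rw [← mul_assoc]
    congr 1
    split_ifs with h
    · obtain ⟨v, hv⟩ := h
      rw [Finset.mem_inter] at hv
      have h0 : (∏ i ∈ ω, if i ∈ Q then 0 else T.prob i) = 0 :=
        Finset.prod_eq_zero (i := v) hv.2 (by rw [if_pos hv.1])
      rw [h0, sub_self, zero_mul]
    · rw [sub_zero, one_mul]
      refine Finset.prod_congr rfl fun v hv => ?_
      rw [if_neg fun hq => h ⟨v, Finset.mem_inter.2 ⟨hq, hv⟩⟩]
  have h2 := T.expectation_one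
  simp only [expectation, sub_mul, Finset.sum_sub_distrib] at h1 h2 ⊢
  linarith

theorem idle_singleton (T : PPTPT n) (v : Fin n) : T.idle {v} = 1 - T.prob v := by simp [idle]

theorem iterate_parent_root (T : PPTPT n) (k : ℕ) : T.parent^[k] T.root = T.root :=
  Function.iterate_fixed T.parent_root k

theorem mem_subtree (T : PPTPT n) {u v : Fin n} : u ∈ T.subtree v ↔ ∃ k, T.parent^[k] u = v := by
  simp [subtree]

theorem subtree_root (T : PPTPT n) : T.subtree T.root = Finset.univ := by
  ext v
  simp [subtree, T.reaches_root v]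

theorem dist_root (T : PPTPT n) : T.dist T.root = 0 := by
  apply Finset.sum_eq_zero
  intro u hu
  obtain ⟨-, h, hu⟩ := Finset.mem_filter.1 hu
  obtain ⟨k, hk⟩ := T.mem_subtree.1 hu
  rw [iterate_parent_root] at hk
  exact absurd hk.symm h

/-- Linearity of expectation. The outer factor `indicator S` of the cost is redundant: when `S` is
idle, so is its part in each sub-tree. -/
theorem expectation_profit (T : PPTPT n) (S : Finset (Fin n)) :
    T.expectation (T.profit S 0) = T.gain (Finset.univ.erase T.root) S 0 := by
  have h1 : T.profit S 0 = fun ω => ∑ s ∈ S, T.prize s * indicator {s} ω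
      - ∑ u ∈ Finset.univ.erase T.root, T.len u * indicator (S ∩ T.subtree u) ω := by
    funext ω
    simp only [profit, revenue, discountedCost, costFrom, dist_root, subtree_root, sub_zero,
      zero_add]
    congr 1
    by_cases h : (S ∩ ω).Nonempty
    · simp [indicator, h]
    · have h' : indicator S ω = 0 := by simp [indicator, h]
      rw [h', mul_zero]
      symm
      apply Finset.sum_eq_zero
      intro u _
      have : ¬ ((S ∩ T.subtree u) ∩ ω).Nonempty := by
        rintro ⟨v, hv⟩
        simp only [Finset.mem_inter] at hv
        exact h ⟨v, Finset.mem_inter.2 ⟨hv.1.1, hv.2⟩⟩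
      rw [indicator, if_neg this, mul_zero]
  have h2 : ∀ Q, ∑ ω, indicator Q ω * T.outcomeProb ω = 1 - T.idle Q := T.expectation_indicator
  rw [h1]
  simp only [expectation, gain, sub_mul, Finset.sum_mul, Finset.sum_sub_distrib, zero_mul, sub_zero]
  rw [Finset.sum_comm, Finset.sum_comm (s := Finset.univ) (t := Finset.univ.erase T.root)]
  simp only [mul_assoc, ← Finset.mul_sum, h2, idle_singleton, sub_sub_cancel]

theorem idle_union (T : PPTPT n) {A B : Finset (Fin n)} (h : Disjoint A B) :
    T.idle (A ∪ B) = T.idle A * T.idle B := Finset.prod_union h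

theorem idle_nonneg (T : PPTPT n) (S : Finset (Fin n)) : 0 ≤ T.idle S :=
  Finset.prod_nonneg fun v _ => sub_nonneg.2 (T.prob_le_one v)

theorem gain_eq (T : PPTPT n) (W S : Finset (Fin n)) (z : ℝ) :
    T.gain W S z = T.gain W S 0 - z * (1 - T.idle S) := by simp [gain]

theorem gain_congr (T : PPTPT n) {W U S S' : Finset (Fin n)} (hW : ∀ u ∈ W, T.subtree u ⊆ U)
    (h : S ∩ U = S' ∩ U) :
    ∑ u ∈ W, T.len u * (1 - T.idle (S ∩ T.subtree u)) =
      ∑ u ∈ W, T.len u * (1 - T.idle (S' ∩ T.subtree u)) := by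
  refine Finset.sum_congr rfl fun u hu => ?_
  have h1 : U ∩ T.subtree u = T.subtree u := Finset.inter_eq_right.2 (hW u hu)
  rw [← h1, ← Finset.inter_assoc, ← Finset.inter_assoc, h]

/-- Edge costs add up because each sub-tree lies on one side. With idle probabilities `a` of `S` and
`b` of `S'`, the identity `1 - a b = (1 - b) + b (1 - a)` charges `z` first to `S'`, and to `S` only
if `S'` is idle. -/
theorem gain_union (T : PPTPT n) {U U' W W' S S' : Finset (Fin n)} (hU : Disjoint U U')
    (hWW : Disjoint W W') (hW : ∀ u ∈ W, T.subtree u ⊆ U) (hW' : ∀ u ∈ W', T.subtree u ⊆ U')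
    (hS : S ⊆ U) (hS' : S' ⊆ U') (z : ℝ) :
    T.gain (W ∪ W') (S ∪ S') z = T.gain W S (z * T.idle S') + T.gain W' S' z := by
  have hd : Disjoint S S' := Finset.disjoint_of_subset_left hS (Finset.disjoint_of_subset_right hS' hU)
  have e1 : (S ∪ S') ∩ U = S ∩ U := by
    rw [Finset.union_inter_distrib_right,
      Finset.disjoint_iff_inter_eq_empty.1 (Finset.disjoint_of_subset_left hS' hU.symm),
      Finset.union_empty]
  have e2 : (S ∪ S') ∩ U' = S' ∩ U' := by
    rw [Finset.union_inter_distrib_right,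
      Finset.disjoint_iff_inter_eq_empty.1 (Finset.disjoint_of_subset_left hS hU),
      Finset.empty_union]
  simp only [gain]
  rw [Finset.sum_union hd, Finset.sum_union hWW, T.gain_congr hW e1, T.gain_congr hW' e2,
    T.idle_union hd]
  ring

/-! ### Lists of blocks that represent a forest -/

/-- The prefixes of the list of blocks `L` are optimal selections among the subsets of `U`, for all
penalties. -/
structure Represents (F : Finset (Fin n) → ℝ → ℝ) (U : Finset (Fin n)) (L : List (Block n)) :
    Prop where
  subset : ∀ b ∈ L, b.nodes ⊆ U
  valid : ∀ b ∈ L, b.Valid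
  nonneg : ∀ b ∈ L, 0 ≤ b.price
  exact : ∀ P, P <+: L → ∀ z, F (union P) z = total P z
  upper : ∀ S ⊆ U, ∀ z, 0 ≤ z → F S z ≤ best L z

theorem Represents.pool {F : Finset (Fin n) → ℝ → ℝ} {U : Finset (Fin n)} {X Y : List (Block n)}
    {a b : Block n} (h : Represents F U (X ++ a :: b :: Y)) (hab : a.price * a.idle ≤ b.price) :
    Represents F U (X ++ a.pool b :: Y) := by
  have ha := h.valid a (by simp)
  have hb := h.valid b (by simp)
  have key : ∀ p : Block n → Prop, (∀ c ∈ X ++ a :: b :: Y, p c) → p (a.pool b) →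
      ∀ c ∈ X ++ a.pool b :: Y, p c := by
    intro p h1 h2 c hc
    rcases List.mem_append.1 hc with hc | hc
    · exact h1 c (by simp [hc])
    · rcases List.mem_cons.1 hc with rfl | hc
      · exact h2
      · exact h1 c (by simp [hc])
  refine ⟨key _ h.subset ?_, key _ h.valid (ha.pool hb),
    key _ h.nonneg (pool_price_nonneg ha hb (h.nonneg a (by simp)) (h.nonneg b (by simp))), ?_, ?_⟩
  · exact Finset.union_subset (h.subset a (by simp)) (h.subset b (by simp))
  · intro P hP z
    obtain ⟨Q, h1, h2, h3⟩ := exists_prefix_pool ha hb hP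
    rw [← h2, ← h3, h.exact Q h1]
  · intro S hS z hz
    exact (h.upper S hS z hz).trans (best_append_mono X (fun z _ => best_pool ha hb hab Y z)
      (fun c hc => h.valid c (by simp [hc])) hz)

theorem Represents.shift {F : Finset (Fin n) → ℝ → ℝ} {U : Finset (Fin n)} {L : List (Block n)}
    (h : Represents F U L) (hL : Ironed L) {x : ℝ} (hx : 0 ≤ x) :
    Represents (fun S z => F S (z + x)) U (shift x L) := by
  refine ⟨fun b hb => ?_, fun b hb => ?_, fun b hb => (shift_spec x hb).1, fun P hP z => ?_,
    fun S hS z hz => ?_⟩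
  · obtain ⟨-, c, hc, h1, h2⟩ := shift_spec x hb
    exact h2 ▸ h.subset c hc
  · obtain ⟨-, c, hc, h1, h2⟩ := shift_spec x hb
    have := h.valid c hc
    rw [Block.Valid, h1] at this
    exact this
  · obtain ⟨Q, h1, h2, h3⟩ := exists_prefix_shift hP
    rw [← h2, ← h3, h.exact Q h1]
  · exact (h.upper S hS _ (add_nonneg hz hx)).trans (best_shift hL h.valid hz)

theorem Represents.union_subset {F : Finset (Fin n) → ℝ → ℝ} {U : Finset (Fin n)}
    {L P : List (Block n)} (h : Represents F U L) (hP : P <+: L) : Block.union P ⊆ U := by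
  intro v hv
  obtain ⟨b, hb, hv⟩ := Block.mem_union.1 hv
  exact h.subset b (hP.subset hb) hv

/-- Both sides of `exact` are affine in the penalty; comparing them at `0` and `1` equates the
slopes. -/
theorem Represents.idle_union {T : PPTPT n} {W U : Finset (Fin n)}
    {L P : List (Block n)} (h : Represents (T.gain W) U L) (hP : P <+: L) :
    T.idle (Block.union P) = idleProd P := by
  have h0 := h.exact P hP 0
  have h1 := h.exact P hP 1
  rw [gain_eq] at h1
  rw [total_eq] at h1
  linarith

/-- The two sides affect each other only through their idle probabilities. Improving one side at a
time replaces any selection by a pair of prefixes, to which `Merge.total_add_total_le` applies. -/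
theorem Represents.merge {T : PPTPT n} {U U' W W' : Finset (Fin n)} {A B M : List (Block n)}
    (hA : Represents (T.gain W) U A) (hB : Represents (T.gain W') U' B) (hM : Merge A B M)
    (hU : Disjoint U U') (hWW : Disjoint W W') (hW : ∀ u ∈ W, T.subtree u ⊆ U)
    (hW' : ∀ u ∈ W', T.subtree u ⊆ U') : Represents (T.gain (W ∪ W')) (U ∪ U') M := by
  have key : ∀ {S S' : Finset (Fin n)}, S ⊆ U → S' ⊆ U' → ∀ z,
      T.gain (W ∪ W') (S ∪ S') z = T.gain W S z + T.gain W' S' (z * T.idle S) := by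
    intro S S' hS hS' z
    rw [Finset.union_comm, Finset.union_comm S,
      T.gain_union hU.symm hWW.symm hW' hW hS' hS, add_comm]
  refine ⟨fun b hb => ?_, fun b hb => ?_, fun b hb => ?_, fun P hP z => ?_, fun S hS z hz => ?_⟩
  · rcases (hM.mem_iff b).1 hb with h | h
    · exact (hA.subset b h).trans Finset.subset_union_left
    · exact (hB.subset b h).trans Finset.subset_union_right
  · exact ((hM.mem_iff b).1 hb).elim (hA.valid b) (hB.valid b)
  · exact ((hM.mem_iff b).1 hb).elim (hA.nonneg b) (hB.nonneg b)
  · obtain ⟨Q, R, h1, h2, h3, h4⟩ := hM.exists_prefix hP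
    rw [h3, h4, key (hA.union_subset h1) (hB.union_subset h2), hA.exact Q h1, hB.exact R h2,
      hA.idle_union h1]
  · have e : S = (S ∩ U) ∪ (S ∩ U') := by
      rw [← Finset.inter_union_distrib_left, Finset.inter_eq_left.2 hS]
    have i1 : S ∩ U ⊆ U := Finset.inter_subset_right
    have i2 : S ∩ U' ⊆ U' := Finset.inter_subset_right
    rw [e]
    -- With `S ∩ U'` kept, `S ∩ U` is replaced by the best prefix `P` at the penalty it faces; then
    -- `S ∩ U'` is replaced at the penalty that `P` leaves over.
    obtain ⟨P, hP, h1⟩ := exists_prefix_best A (z * T.idle (S ∩ U'))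
    obtain ⟨Q, hQ, h2⟩ := exists_prefix_best B (z * idleProd P)
    have h3 := hA.upper _ i1 (z * T.idle (S ∩ U')) (mul_nonneg hz (T.idle_nonneg _))
    have h4 := hB.upper _ i2 (z * idleProd P) (mul_nonneg hz
      (idleProd_nonneg fun b hb => hA.valid b (hP.subset hb)))
    have h5 := T.gain_union hU hWW hW hW' i1 i2 z
    have h6 := T.gain_union hU hWW hW hW' (hA.union_subset hP) i2 z
    rw [key (hA.union_subset hP) i2, hA.exact P hP, hA.exact P hP, hA.idle_union hP] at h6
    have h7 := hM.total_add_total_le hA.valid hB.valid hP hQ hz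
    linarith

theorem isOptimalSet_union (T : PPTPT n) {L : List (Block n)}
    (h : Represents (T.gain (Finset.univ.erase T.root)) Finset.univ L) :
    T.IsOptimalSet (Block.union L) := by
  intro S
  rw [expectation_profit, expectation_profit]
  refine (h.upper S (Finset.subset_univ S) 0 le_rfl).trans ?_
  rw [best_zero h.valid h.nonneg, h.exact L (List.prefix_refl L)]

/-- The edge above `v` is a penalty for the sub-tree of `v`. -/
theorem gain_insert (T : PPTPT n) {v : Fin n} {W S : Finset (Fin n)} (hv : v ∉ W)
    (hS : S ⊆ T.subtree v) (z : ℝ) : T.gain (insert v W) S z = T.gain W S (z + T.len v) := by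
  rw [gain, gain, Finset.sum_insert hv, Finset.inter_eq_left.2 hS]
  ring

theorem Represents.insert_edge {T : PPTPT n} {v : Fin n} {W : Finset (Fin n)} {L : List (Block n)}
    (hv : v ∉ W) (h : Represents (fun S z => T.gain W S (z + T.len v)) (T.subtree v) L) :
    Represents (T.gain (insert v W)) (T.subtree v) L := by
  refine ⟨h.subset, h.valid, h.nonneg, fun P hP z => ?_, fun S hS z hz => ?_⟩
  · rw [T.gain_insert hv (h.union_subset hP)]
    exact h.exact P hP z
  · rw [T.gain_insert hv hS]
    exact h.upper S hS z hz

theorem gain_singleton (T : PPTPT n) (v : Fin n) (z : ℝ) :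
    T.gain ∅ {v} z = (T.prize v - z) * T.prob v := by
  simp only [gain, Finset.sum_singleton, Finset.sum_empty, sub_zero, idle_singleton]
  ring

theorem gain_empty (T : PPTPT n) (z : ℝ) : T.gain ∅ ∅ z = 0 := by simp [gain, idle]

theorem represents_singleton (T : PPTPT n) {v : Fin n} (h : 0 ≤ T.prize v) :
    Represents (T.gain ∅) {v} [⟨T.prize v, 1 - T.prob v, {v}⟩] := by
  refine ⟨by simp, ?_, by simpa, fun P hP z => ?_, fun S hS z hz => ?_⟩
  · simp [Block.Valid, T.prob_pos, T.prob_le_one]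
  · rcases P with _ | ⟨b, P⟩
    · simp [Block.union, total, gain_empty]
    · rw [List.cons_prefix_cons, List.prefix_nil] at hP
      obtain ⟨rfl, rfl⟩ := hP
      simp [Block.union, total, gain_singleton]
  · rcases Finset.subset_singleton_iff.1 hS with rfl | rfl
    · rw [gain_empty]
      exact best_nonneg _ _
    · simp [best, gain_singleton]

/-- A node of negative prize is a loss at every `z ≥ 0`; dropping it at once keeps all prices in the
list nonnegative. -/
theorem represents_nil (T : PPTPT n) {v : Fin n} (h : T.prize v < 0) :
    Represents (T.gain ∅) {v} [] := by
  refine ⟨by simp, by simp, by simp, fun P hP z => ?_, fun S hS z hz => ?_⟩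
  · rw [List.prefix_nil] at hP
    subst hP
    simp [Block.union, total, gain_empty]
  · rcases Finset.subset_singleton_iff.1 hS with rfl | rfl
    · simp [gain_empty, best]
    · rw [gain_singleton]
      exact mul_nonpos_of_nonpos_of_nonneg (by linarith) (T.prob_pos v).le

end PPTPT

/-! Total correctness of programs with a bound on the number of steps. -/

namespace RealRAM

/-- The program halts within `t` steps in a state that satisfies `Q`. -/
def Within (P : Prog) (s : State) (t : ℕ) (Q : State → Prop) : Prop :=
  ∃ s' t', Exec P s s' t' ∧ t' ≤ t ∧ Q s'

namespace Prog

/-- The program contains no loop. -/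
def Flat : Prog → Prop
  | skip | setNat _ _ | setReal _ _ | putNat _ _ _ | putReal _ _ _ => True
  | seq p q => p.Flat ∧ q.Flat
  | ite _ p q => p.Flat ∧ q.Flat
  | loop _ _ => False

open scoped Classical in
/-- The final state of a loop-free program. -/
noncomputable def flat : Prog → State → State
  | skip, s => s
  | setNat r e, s => s.setNat r (e.eval s)
  | setReal r e, s => s.setReal r (e.eval s)
  | putNat a i e, s => s.putNat a (i.eval s) (e.eval s)
  | putReal a i e, s => s.putReal a (i.eval s) (e.eval s)
  | seq p q, s => q.flat (p.flat s)
  | ite b p q, s => if b.Holds s then p.flat s else q.flat s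
  | loop _ _, s => s

/-- An upper bound for the number of steps of a loop-free program. -/
def flatCost : Prog → ℕ
  | skip => 1
  | setNat _ e => e.cost + 1
  | setReal _ e => e.cost + 1
  | putNat _ i e => i.cost + e.cost + 1
  | putReal _ i e => i.cost + e.cost + 1
  | seq p q => p.flatCost + q.flatCost
  | ite b p q => b.cost + max p.flatCost q.flatCost + 1
  | loop _ _ => 0

end Prog

theorem Within.flat {P : Prog} (hP : P.Flat) {s : State} {Q : State → Prop} (h : Q (P.flat s)) :
    Within P s P.flatCost Q := by
  suffices ∃ t', Exec P s (P.flat s) t' ∧ t' ≤ P.flatCost by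
    obtain ⟨t', h1, h2⟩ := this
    exact ⟨_, t', h1, h2, h⟩
  clear h
  induction P generalizing s with
  | skip => exact ⟨_, .skip s, le_rfl⟩
  | setNat r e => exact ⟨_, .setNat s r e, le_rfl⟩
  | setReal r e => exact ⟨_, .setReal s r e, le_rfl⟩
  | putNat a i e => exact ⟨_, .putNat s a i e, le_rfl⟩
  | putReal a i e => exact ⟨_, .putReal s a i e, le_rfl⟩
  | seq p q ihp ihq =>
    obtain ⟨t₁, h1, h2⟩ := ihp hP.1 (s := s)
    obtain ⟨t₂, h3, h4⟩ := ihq hP.2 (s := p.flat s)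
    exact ⟨_, .seq h1 h3, Nat.add_le_add h2 h4⟩
  | ite b p q ihp ihq =>
    simp only [Prog.flat, Prog.flatCost]
    split_ifs with hb
    · obtain ⟨t₁, h1, h2⟩ := ihp hP.1 (s := s)
      exact ⟨_, .iteTrue hb h1, by omega⟩
    · obtain ⟨t₁, h1, h2⟩ := ihq hP.2 (s := s)
      exact ⟨_, .iteFalse hb h1, by omega⟩
  | loop b p => exact hP.elim

theorem Within.mono {P : Prog} {s : State} {t t' : ℕ} {Q Q' : State → Prop}
    (h : Within P s t Q) (ht : t ≤ t') (hQ : ∀ s', Q s' → Q' s') : Within P s t' Q' := by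
  obtain ⟨s', t₁, h1, h2, h3⟩ := h
  exact ⟨s', t₁, h1, h2.trans ht, hQ _ h3⟩

theorem Within.seq {P P' : Prog} {s : State} {t t' : ℕ} {Q : State → Prop}
    (h : Within P s t fun s' => Within P' s' t' Q) : Within (Prog.seq P P') s (t + t') Q := by
  obtain ⟨s', t₁, h1, h2, s'', t₂, h3, h4, h5⟩ := h
  exact ⟨s'', _, .seq h1 h3, Nat.add_le_add h2 h4, h5⟩

/-- The first part of a sequence is loop-free. -/
theorem Within.flat_seq {P P' : Prog} (hP : P.Flat) {s : State} {t : ℕ} {Q : State → Prop}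
    (h : Within P' (P.flat s) t Q) : Within (Prog.seq P P') s (P.flatCost + t) Q :=
  Within.seq (Within.flat hP h)

/-- The index `m` only bounds the number of remaining iterations, so it may drop by more than one.
The summand outside the product pays for the failing test. -/
theorem Within.loop {b : Test} {P : Prog} {c : ℕ} (I : ℕ → State → Prop)
    (hI : ∀ m s, I m s → b.Holds s → Within P s c fun s' => ∃ m' < m, I m' s') {m : ℕ} {s : State}
    (h : I m s) : Within (Prog.loop b P) s (m * (b.cost + c + 1) + (b.cost + 1))
      fun s' => (∃ m', I m' s') ∧ ¬ b.Holds s' := by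
  induction m using Nat.strong_induction_on generalizing s with
  | _ m ih =>
    by_cases hb : b.Holds s
    · obtain ⟨s₁, t₁, h1, h2, m', hm, h3⟩ := hI m s h hb
      obtain ⟨s₂, t₂, h4, h5, h6⟩ := ih m' hm h3
      refine ⟨s₂, _, .loopTrue hb h1 h4, ?_, h6⟩
      have : (m' + 1) * (b.cost + c + 1) ≤ m * (b.cost + c + 1) := Nat.mul_le_mul_right _ hm
      rw [Nat.add_mul, one_mul] at this
      omega
    · exact ⟨s, _, .loopFalse hb, by omega, ⟨m, h⟩, hb⟩

/-- A loop with a loop-free body. -/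
theorem Within.flat_loop {b : Test} {P : Prog} (hP : P.Flat) (I : ℕ → State → Prop)
    (hI : ∀ m s, I m s → b.Holds s → ∃ m' < m, I m' (P.flat s)) {m : ℕ} {s : State}
    (h : I m s) : Within (Prog.loop b P) s (m * (b.cost + P.flatCost + 1) + (b.cost + 1))
      fun s' => (∃ m', I m' s') ∧ ¬ b.Holds s' :=
  Within.loop I (fun m s h hb => Within.flat hP (hI m s h hb)) h

namespace State

variable (s : State) (r a i : ℕ) (x : ℕ) (y : ℝ)

@[simp] theorem setNat_natReg : (s.setNat r x).natReg = Function.update s.natReg r x := rfl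
@[simp] theorem setNat_realReg : (s.setNat r x).realReg = s.realReg := rfl
@[simp] theorem setNat_natArr : (s.setNat r x).natArr = s.natArr := rfl
@[simp] theorem setNat_realArr : (s.setNat r x).realArr = s.realArr := rfl
@[simp] theorem setReal_natReg : (s.setReal r y).natReg = s.natReg := rfl
@[simp] theorem setReal_realReg : (s.setReal r y).realReg = Function.update s.realReg r y := rfl
@[simp] theorem setReal_natArr : (s.setReal r y).natArr = s.natArr := rfl
@[simp] theorem setReal_realArr : (s.setReal r y).realArr = s.realArr := rfl
@[simp] theorem putNat_natReg : (s.putNat a i x).natReg = s.natReg := rfl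
@[simp] theorem putNat_realReg : (s.putNat a i x).realReg = s.realReg := rfl
@[simp] theorem putNat_natArr : (s.putNat a i x).natArr =
    Function.update s.natArr a (Function.update (s.natArr a) i x) := rfl
@[simp] theorem putNat_realArr : (s.putNat a i x).realArr = s.realArr := rfl
@[simp] theorem putReal_natReg : (s.putReal a i y).natReg = s.natReg := rfl
@[simp] theorem putReal_realReg : (s.putReal a i y).realReg = s.realReg := rfl
@[simp] theorem putReal_natArr : (s.putReal a i y).natArr = s.natArr := rfl
@[simp] theorem putReal_realArr : (s.putReal a i y).realArr =
    Function.update s.realArr a (Function.update (s.realArr a) i y) := rfl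

end State

/-! ### Array segments read as lists -/

/-- The cells `lo, …, hi - 1` of an array, in descending order of the index. -/
def seg {α : Type} (M : ℕ → α) (lo hi : ℕ) : List α := ((List.range' lo (hi - lo)).map M).reverse

section seg

variable {α : Type} {M M' : ℕ → α} {lo mid hi : ℕ}

theorem mem_seg {x : α} : x ∈ seg M lo hi ↔ ∃ i, lo ≤ i ∧ i < hi ∧ M i = x := by
  simp only [seg, List.mem_reverse, List.mem_map, List.mem_range'_1]
  constructor
  · rintro ⟨i, h, rfl⟩
    exact ⟨i, h.1, by omega, rfl⟩
  · rintro ⟨i, h1, h2, rfl⟩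
    exact ⟨i, ⟨h1, by omega⟩, rfl⟩

@[simp] theorem length_seg : (seg M lo hi).length = hi - lo := by simp [seg]

@[simp] theorem seg_self : seg M lo lo = [] := by simp [seg]

theorem seg_congr (h : ∀ i, lo ≤ i → i < hi → M i = M' i) : seg M lo hi = seg M' lo hi := by
  simp only [seg]
  congr 1
  refine List.map_congr_left fun i hi => ?_
  rw [List.mem_range'_1] at hi
  exact h i hi.1 (by omega)

/-- The order is descending, so higher addresses come first and the head of a list lies on top, as
in a stack. -/
theorem seg_append (h : lo ≤ mid) (h' : mid ≤ hi) :
    seg M lo hi = seg M mid hi ++ seg M lo mid := by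
  simp only [seg]
  rw [← List.reverse_append, ← List.map_append]
  have e : mid = lo + (mid - lo) := by omega
  have : List.range' lo (mid - lo) ++ List.range' mid (hi - mid) = List.range' lo (hi - lo) := by
    conv_lhs => rw [e]
    rw [Nat.add_sub_cancel_left, List.range'_append_1]
    congr 1
    omega
  rw [this]

theorem seg_succ (h : lo ≤ hi) : seg M lo (hi + 1) = M hi :: seg M lo hi := by
  rw [seg_append h (Nat.le_succ hi)]
  simp [seg]

theorem seg_bot (h : lo < hi) : seg M lo hi = seg M (lo + 1) hi ++ [M lo] := by
  rw [seg_append (Nat.le_succ lo) h]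
  simp [seg]

theorem seg_top (h : lo < hi) : seg M lo hi = M (hi - 1) :: seg M lo (hi - 1) := by
  obtain ⟨k, rfl⟩ := Nat.exists_eq_add_of_lt h
  exact seg_succ (by omega)

theorem seg_push (h : lo ≤ hi) (x : α) :
    seg (Function.update M hi x) lo (hi + 1) = x :: seg M lo hi := by
  rw [seg_succ h, Function.update_self]
  congr 1
  exact seg_congr fun i _ hi => Function.update_of_ne (by omega) _ _

end seg

/-! ### Pointer forests and their clusters -/

/-- The nodes from which the fixed point `a` is reached by following pointers. -/
noncomputable def cluster (n : ℕ) (f : ℕ → ℕ) (a : ℕ) : Finset (Fin n) :=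
  open scoped Classical in Finset.univ.filter fun u => ∃ k, f^[k] u = a

theorem mem_cluster {n : ℕ} {f : ℕ → ℕ} {a : ℕ} {u : Fin n} :
    u ∈ cluster n f a ↔ ∃ k, f^[k] u = a := by simp [cluster]

section cluster

variable {f : ℕ → ℕ} {a b c : ℕ}

/-- A path to `c` never visits the fixed point `b`, so redirecting `b` does not affect it. -/
theorem exists_iterate_update_of (hb : f b = b) (hc : c ≠ b) {k u : ℕ} (h : f^[k] u = c) :
    (Function.update f b a)^[k] u = c := by
  induction k generalizing u with
  | zero => exact h
  | succ k ih =>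
    rw [Function.iterate_succ_apply] at h ⊢
    have hu : u ≠ b := by
      rintro rfl
      rw [hb, Function.iterate_fixed hb] at h
      exact hc h.symm
    rw [Function.update_of_ne hu]
    exact ih h

theorem exists_iterate_update_of_self {k u : ℕ} (h : f^[k] u = b) :
    ∃ l, (Function.update f b a)^[l] u = a := by
  induction k generalizing u with
  | zero => exact ⟨1, by simp [show u = b from h]⟩
  | succ k ih =>
    by_cases hu : u = b
    · exact ⟨1, by simp [hu]⟩
    · rw [Function.iterate_succ_apply] at h
      obtain ⟨l, hl⟩ := ih h
      exact ⟨l + 1, by rw [Function.iterate_succ_apply, Function.update_of_ne hu, hl]⟩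

/-- A path in the redirected forest either is an old path, or it reaches `b`, jumps to `a` and stays
there. -/
theorem of_iterate_update (ha : f a = a) (hab : a ≠ b) {k u : ℕ}
    (h : (Function.update f b a)^[k] u = c) :
    (∃ l, f^[l] u = c) ∨ (c = a ∧ ∃ l, f^[l] u = b) := by
  induction k generalizing u with
  | zero => exact Or.inl ⟨0, h⟩
  | succ k ih =>
    by_cases hu : u = b
    · have ha' : Function.update f b a a = a := by rw [Function.update_of_ne hab, ha]
      rw [Function.iterate_succ_apply, hu, Function.update_self, Function.iterate_fixed ha'] at h
      exact Or.inr ⟨h.symm, 0, hu⟩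
    · rw [Function.iterate_succ_apply, Function.update_of_ne hu] at h
      rcases ih h with ⟨l, hl⟩ | ⟨h1, l, hl⟩
      · exact Or.inl ⟨l + 1, by rwa [Function.iterate_succ_apply]⟩
      · exact Or.inr ⟨h1, l + 1, by rwa [Function.iterate_succ_apply]⟩

theorem cluster_update_of_ne {n : ℕ} (ha : f a = a) (hb : f b = b) (hab : a ≠ b) (hca : c ≠ a)
    (hcb : c ≠ b) : cluster n (Function.update f b a) c = cluster n f c := by
  ext u
  simp only [mem_cluster]
  constructor
  · rintro ⟨k, h⟩
    rcases of_iterate_update ha hab h with h | h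
    · exact h
    · exact absurd h.1 hca
  · rintro ⟨k, h⟩
    exact ⟨k, exists_iterate_update_of hb hcb h⟩

theorem cluster_update_self {n : ℕ} (ha : f a = a) (hb : f b = b) (hab : a ≠ b) :
    cluster n (Function.update f b a) a = cluster n f a ∪ cluster n f b := by
  ext u
  simp only [mem_cluster, Finset.mem_union]
  constructor
  · rintro ⟨k, h⟩
    rcases of_iterate_update ha hab h with h | h
    · exact Or.inl h
    · exact Or.inr h.2
  · rintro (⟨k, h⟩ | ⟨k, h⟩)
    · exact ⟨k, exists_iterate_update_of hb hab h⟩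
    · exact exists_iterate_update_of_self h

/-- Pigeonhole: the nodes before the first visit to `a` are distinct and below `n`, so `n` steps
suffice, and surplus steps stay at `a`. -/
theorem mem_cluster_iff_iterate {n : ℕ} (hf : ∀ u < n, f u < n) (ha : f a = a) {u : Fin n} :
    u ∈ cluster n f a ↔ f^[n] u = a := by
  rw [mem_cluster]
  refine ⟨fun h => ?_, fun h => ⟨n, h⟩⟩
  classical
  have hk := Nat.find_spec h
  have hmin : ∀ m < Nat.find h, f^[m] u ≠ a := fun m hm => Nat.find_min h hm
  set k := Nat.find h
  have hlt : ∀ m, f^[m] u < n := by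
    intro m
    induction m with
    | zero => exact u.2
    | succ m ih => rw [Function.iterate_succ_apply']; exact hf _ ih
  have hinj : Set.InjOn (fun m => f^[m] (u : ℕ)) (Finset.range k : Set ℕ) := by
    have aux : ∀ i j, i < j → j < k → f^[i] (u : ℕ) ≠ f^[j] u := by
      intro i j hij hjk hc
      -- A repetition would be a shortcut: continuing from its first occurrence reaches `a` in fewer
      -- than `k` steps.
      apply hmin (k - j + i) (by omega)
      rw [Function.iterate_add_apply, hc, ← Function.iterate_add_apply, Nat.sub_add_cancel hjk.le,
        hk]
    intro i hi j hj hij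
    simp only [Finset.coe_range, Set.mem_Iio] at hi hj
    rcases lt_trichotomy i j with h1 | h1 | h1
    · exact absurd hij (aux i j h1 hj)
    · exact h1
    · exact absurd hij.symm (aux j i h1 hi)
  have hcard : k ≤ n := by
    have := Finset.card_le_card_of_injOn (s := Finset.range k) (t := Finset.range n) _
      (fun m _ => by simpa using hlt m) hinj
    simpa using this
  have h1 : f^[n - k + k] (u : ℕ) = a := by
    rw [Function.iterate_add_apply, hk, Function.iterate_fixed ha]
  rwa [Nat.sub_add_cancel hcard] at h1

end cluster

end RealRAM

/-! The program. Index registers: `0` number of nodes, `1` root, `2` round, `3` current node,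
`4` first free memory cell; the others are temporary. Index arrays: `0` parents, `1` output,
`2` number of pending children, `3` and `4` bounds of the list of blocks of a node, `5` memory that
holds the lists, `6` pointers that join nodes to blocks, `7` selected blocks. Real arrays: `0` edge
lengths, `1` prices and `2` idle probabilities of the blocks. -/

namespace RealRAM

open PPTPT

/-- The block with representative `a`. -/
noncomputable def block (n : ℕ) (s : State) (a : ℕ) : Block n :=
  ⟨s.realArr 1 a, s.realArr 2 a, cluster n (s.natArr 6) a⟩

/-- The list of blocks of node `v`, by representatives. -/
def reps (s : State) (v : ℕ) : List ℕ := seg (s.natArr 5) (s.natArr 3 v) (s.natArr 4 v)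

/-- What remains unchanged while the list `L` of blocks is being transformed. -/
structure Frame (n : ℕ) (L : List ℕ) (s₀ s : State) : Prop where
  natReg : ∀ r < 5, s.natReg r = s₀.natReg r
  natArr : ∀ a, a ≠ 5 → a ≠ 6 → s.natArr a = s₀.natArr a
  realArr : ∀ a, a ≠ 1 → a ≠ 2 → s.realArr a = s₀.realArr a
  mem : ∀ i < s₀.natReg 4, s.natArr 5 i = s₀.natArr 5 i
  block : ∀ c ∉ L, s₀.natArr 6 c = c → block n s c = block n s₀ c ∧ s.natArr 6 c = c
  ptr_lt : (∀ u < n, s₀.natArr 6 u < n) → ∀ u < n, s.natArr 6 u < n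

theorem Frame.trans {n : ℕ} {L L' : List ℕ} {s₀ s₁ s₂ : State} (h : Frame n L s₀ s₁)
    (h' : Frame n L' s₁ s₂) (hL : ∀ c ∈ L', c ∈ L) : Frame n L s₀ s₂ := by
  refine ⟨fun r hr => (h'.natReg r hr).trans (h.natReg r hr),
    fun a h1 h2 => (h'.natArr a h1 h2).trans (h.natArr a h1 h2),
    fun a h1 h2 => (h'.realArr a h1 h2).trans (h.realArr a h1 h2),
    fun i hi => (h'.mem i (by rwa [h.natReg 4 (by norm_num)])).trans (h.mem i hi),
    fun c hc hc' => ?_, fun hu => h'.ptr_lt (h.ptr_lt hu)⟩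
  obtain ⟨h1, h2⟩ := h.block c hc hc'
  obtain ⟨h3, h4⟩ := h'.block c (fun hc' => hc (hL c hc')) h2
  exact ⟨h3.trans h1, h4⟩

/-- Find a node without pending children. -/
def findLeaf : Prog :=
  .seq (.setNat 3 (.const 0))
    (.loop (.neg (.natEq (.get 2 (.reg 3)) (.const 0))) (.setNat 3 (.add (.reg 3) (.const 1))))

theorem findLeaf_within {n : ℕ} {s : State} (h : ∃ v < n, s.natArr 2 v = 0) :
    Within findLeaf s (10 * n + 8) fun s' => ∃ v < n, s.natArr 2 v = 0 ∧ s' = s.setNat 3 v := by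
  obtain ⟨w, hw, hw0⟩ := h
  -- The scan cannot pass the known zero `w`, so the distance to `w` is the measure; it may stop
  -- earlier.
  refine (Within.flat_seq (by simp [Prog.Flat]) (Within.flat_loop (by simp [Prog.Flat])
    (fun m s' => ∃ v ≤ w, m = w - v ∧ s' = s.setNat 3 v) ?_ (m := w) ⟨0, by simp, by simp, rfl⟩)).mono
    ?_ ?_
  · rintro m _ ⟨v, hv, rfl, rfl⟩ hb
    simp only [Test.Holds, NatExpr.eval, State.setNat_natReg, Function.update_self,
      State.setNat_natArr] at hb
    have : v ≠ w := by rintro rfl; exact hb hw0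
    refine ⟨w - (v + 1), by omega, v + 1, by omega, rfl, ?_⟩
    simp [Prog.flat, NatExpr.eval, State.setNat]
  · simp only [Test.cost, NatExpr.cost, Prog.flatCost]
    omega
  · rintro _ ⟨⟨m, v, hv, -, rfl⟩, hb⟩
    simp only [Test.Holds, NatExpr.eval, State.setNat_natReg, Function.update_self,
      State.setNat_natArr, not_not] at hb
    exact ⟨v, by omega, hb, rfl⟩

/-- Pool the block `M[i]` with the topmost block of the stack, or push it. -/
def ironBody : Prog :=
  let a : NatExpr := .get 5 (.reg 5)
  let b : NatExpr := .get 5 (.sub (.reg 6) (.const 1))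
  .ite (.and (.natLt (.reg 4) (.reg 6))
      (.neg (.realLt (.get 1 b) (.mul (.get 1 a) (.get 2 a)))))
    (.seq (.putReal 1 a (.div
        (.add (.mul (.get 1 a) (.sub (.const 1) (.get 2 a)))
          (.mul (.get 1 b) (.sub (.const 1) (.get 2 b))))
        (.sub (.const 1) (.mul (.get 2 a) (.get 2 b)))))
      (.seq (.putReal 2 a (.mul (.get 2 a) (.get 2 b)))
        (.seq (.putNat 6 b a) (.setNat 6 (.sub (.reg 6) (.const 1))))))
    (.seq (.putNat 5 (.reg 6) a)
      (.seq (.setNat 6 (.add (.reg 6) (.const 1))) (.setNat 5 (.add (.reg 5) (.const 1)))))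

/-- Iron the list of blocks of the current node. -/
def iron : Prog :=
  .seq (.seq (.setNat 5 (.get 3 (.reg 3))) (.setNat 6 (.reg 4)))
    (.loop (.natLt (.reg 5) (.get 4 (.reg 3))) ironBody)

/-- The part of the list `seg M i hi` and of the stack at `fp` that `iron` maintains. -/
structure IronInv (n : ℕ) (F : Finset (Fin n) → ℝ → ℝ) (U : Finset (Fin n)) (s₀ : State) (v : ℕ)
    (m : ℕ) (s : State) : Prop where
  frame : Frame n (reps s₀ v) s₀ s
  low : s₀.natArr 3 v ≤ s.natReg 5
  high : s.natReg 5 ≤ s₀.natArr 4 v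
  stack : s₀.natReg 4 ≤ s.natReg 6
  measure : m = 2 * (s₀.natArr 4 v - s.natReg 5) + (s.natReg 6 - s₀.natReg 4)
  nodup : (seg (s₀.natArr 5) (s.natReg 5) (s₀.natArr 4 v) ++
    seg (s.natArr 5) (s₀.natReg 4) (s.natReg 6)).Nodup
  mem : ∀ c ∈ seg (s₀.natArr 5) (s.natReg 5) (s₀.natArr 4 v) ++
    seg (s.natArr 5) (s₀.natReg 4) (s.natReg 6), c ∈ reps s₀ v ∧ s.natArr 6 c = c
  represents : Represents F U ((seg (s₀.natArr 5) (s.natReg 5) (s₀.natArr 4 v) ++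
    seg (s.natArr 5) (s₀.natReg 4) (s.natReg 6)).map (block n s))
  ironed : Block.Ironed ((seg (s.natArr 5) (s₀.natReg 4) (s.natReg 6)).map (block n s))

/-- The unread part followed by the stack remains a representing list. A push only moves the
boundary; a pool is covered by `Represents.pool` and keeps the pooled block unread, to be compared
with the next top. Unread blocks count twice in the measure, since each may still be pushed and
later popped. -/
theorem ironInv_step {n : ℕ} {F : Finset (Fin n) → ℝ → ℝ} {U : Finset (Fin n)} {s₀ : State} {v : ℕ}
    (hv : s₀.natReg 3 = v) (hhi : s₀.natArr 4 v ≤ s₀.natReg 4) (hlt : ∀ c ∈ reps s₀ v, c < n)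
    {m : ℕ} {s : State} (h : IronInv n F U s₀ v m s)
    (hb : (Test.natLt (.reg 5) (.get 4 (.reg 3))).Holds s) :
    ∃ m' < m, IronInv n F U s₀ v m' (ironBody.flat s) := by
  obtain ⟨hf, hlow, hhigh, hstack, rfl, hnd, hmem, hrep, hiron⟩ := h
  have hi : s.natReg 5 < s₀.natArr 4 v := by
    simpa [Test.Holds, NatExpr.eval, hf.natReg 3 (by norm_num), hf.natArr 4 (by norm_num)
      (by norm_num), hv] using hb
  have ha : s.natArr 5 (s.natReg 5) = s₀.natArr 5 (s.natReg 5) := hf.mem _ (by omega)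
  have h4 : s.natReg 4 = s₀.natReg 4 := hf.natReg 4 (by norm_num)
  have hseg := seg_bot (M := s₀.natArr 5) hi
  set a := s₀.natArr 5 (s.natReg 5) with ha_def
  set X := seg (s₀.natArr 5) (s.natReg 5 + 1) (s₀.natArr 4 v) with hX
  simp only [ironBody, Prog.flat]
  split_ifs with hc
  · simp only [Test.Holds, NatExpr.eval, RealExpr.eval, ha, h4, not_lt] at hc
    obtain ⟨hc1, hc2⟩ := hc
    have htop := seg_top (M := s.natArr 5) hc1
    set b := s.natArr 5 (s.natReg 6 - 1) with hb_def
    set Y := seg (s.natArr 5) (s₀.natReg 4) (s.natReg 6 - 1) with hY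
    rw [hseg, htop] at hnd hmem hrep
    rw [htop] at hiron
    have hab : a ≠ b := by
      rintro e
      simp [List.nodup_append, e] at hnd
    -- Representatives are distinct, so overwriting the data of `a` and the pointer of `b` leaves
    -- the other blocks alone.
    have haX : ∀ c ∈ X ++ Y, c ≠ a ∧ c ≠ b := by
      intro c hcm
      simp only [List.append_assoc, List.singleton_append, List.nodup_append, List.nodup_cons,
        List.mem_cons, List.mem_append] at hnd hcm
      grind
    have ham := hmem a (by simp)
    have hbm := hmem b (by simp)
    set s' := (((s.putReal 1 a ((s.realArr 1 a * (1 - s.realArr 2 a) +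
      s.realArr 1 b * (1 - s.realArr 2 b)) / (1 - s.realArr 2 a * s.realArr 2 b))).putReal 2 a
      (s.realArr 2 a * s.realArr 2 b)).putNat 6 b a).setNat 6 (s.natReg 6 - 1) with hs'
    have hblk : ∀ c, s.natArr 6 c = c → c ≠ a → c ≠ b → block n s' c = block n s c := by
      intro c h1 h2 h3
      simp [block, hs', h2, cluster_update_of_ne ham.2 hbm.2 hab h2 h3]
    have hblka : block n s' a = (block n s a).pool (block n s b) := by
      simp [block, hs', Block.pool, cluster_update_self ham.2 hbm.2 hab]
    have hptr : ∀ c, c ≠ b → s'.natArr 6 c = s.natArr 6 c := by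
      intro c h
      simp [hs', h]
    have hfl : ∀ t, t = s' → ∃ m' < 2 * (s₀.natArr 4 v - s.natReg 5) +
        (s.natReg 6 - s₀.natReg 4), IronInv n F U s₀ v m' t := by
      rintro _ rfl
      have e5 : s'.natReg 5 = s.natReg 5 := by simp [hs']
      have e6 : s'.natReg 6 = s.natReg 6 - 1 := by simp [hs']
      have eM : s'.natArr 5 = s.natArr 5 := by simp [hs']
      refine ⟨2 * (s₀.natArr 4 v - s.natReg 5) + (s.natReg 6 - 1 - s₀.natReg 4), by omega, ?_⟩
      constructor
      · refine ⟨fun r hr => ?_, fun c h1 h2 => ?_, fun c h1 h2 => ?_, fun i hi => ?_,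
          fun c h1 h2 => ?_, fun hu u hun => ?_⟩
        · rw [← hf.natReg r hr]
          have : r ≠ 6 := by omega
          simp [hs', this]
        · rw [← hf.natArr c h1 h2]
          simp [hs', h2]
        · rw [← hf.realArr c h1 h2]
          simp [hs', h1, h2]
        · rw [eM, hf.mem i hi]
        · have hca : c ≠ a := by rintro rfl; exact h1 ham.1
          have hcb : c ≠ b := by rintro rfl; exact h1 hbm.1
          obtain ⟨h3, h4⟩ := hf.block c h1 h2
          exact ⟨(hblk c h4 hca hcb).trans h3, by rw [hptr c hcb, h4]⟩
        · by_cases hub : u = b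
          · have : s'.natArr 6 u = a := by simp [hs', hub]
            rw [this]
            exact hlt a ham.1
          · rw [hptr u hub]
            exact hf.ptr_lt hu u hun
      · rw [e5]; exact hlow
      · rw [e5]; exact hhigh
      · rw [e6]; omega
      · rw [e5, e6]
      all_goals rw [e6, eM]
      · rw [e5, hseg]
        exact hnd.sublist (by simp [hY])
      · rw [e5, hseg]
        intro c hcm
        have h1 := hmem c (by simp at hcm ⊢; tauto)
        have hcb : c ≠ b := by
          by_cases hca : c = a
          · rw [hca]; exact hab
          · exact (haX c (by simp at hcm ⊢; tauto)).2
        exact ⟨h1.1, by rw [hptr c hcb, h1.2]⟩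
      · rw [e5, hseg]
        simp only [List.append_assoc, List.singleton_append, List.map_append, List.map_cons]
          at hrep ⊢
        have := hrep.pool hc2
        rw [hblka]
        have hX' : X.map (block n s') = X.map (block n s) :=
          List.map_congr_left fun c hcm => hblk c (hmem c (by simp [hcm])).2
            (haX c (by simp [hcm])).1 (haX c (by simp [hcm])).2
        have hY' : Y.map (block n s') = Y.map (block n s) :=
          List.map_congr_left fun c hcm => hblk c (hmem c (by simp [hcm])).2
            (haX c (by simp [hcm])).1 (haX c (by simp [hcm])).2
        rw [hX', hY']
        exact this
      · have hY' : Y.map (block n s') = Y.map (block n s) :=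
          List.map_congr_left fun c hcm => hblk c (hmem c (by simp [hcm])).2
            (haX c (by simp [hcm])).1 (haX c (by simp [hcm])).2
        rw [hY']
        exact List.IsChain.tail hiron
    apply hfl
    simp only [NatExpr.eval, RealExpr.eval, State.putReal_natReg, State.putReal_natArr,
      State.putReal_realArr, State.putNat_natReg, ha, ← hb_def, hs',
      Nat.cast_one]
    simp
  · set s' := ((s.putNat 5 (s.natReg 6) a).setNat 6 (s.natReg 6 + 1)).setNat 5 (s.natReg 5 + 1)
      with hs'
    have hfl : ∀ t, t = s' → ∃ m' < 2 * (s₀.natArr 4 v - s.natReg 5) +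
        (s.natReg 6 - s₀.natReg 4), IronInv n F U s₀ v m' t := by
      rintro _ rfl
      have e5 : s'.natReg 5 = s.natReg 5 + 1 := by simp [hs']
      have e6 : s'.natReg 6 = s.natReg 6 + 1 := by simp [hs']
      have eM : s'.natArr 5 = Function.update (s.natArr 5) (s.natReg 6) a := by simp [hs']
      have hptr : s'.natArr 6 = s.natArr 6 := by simp [hs']
      have hblk : block n s' = block n s := by
        funext c
        simp [block, hs']
      have hst : seg (s'.natArr 5) (s₀.natReg 4) (s'.natReg 6) =
          a :: seg (s.natArr 5) (s₀.natReg 4) (s.natReg 6) := by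
        rw [eM, e6, seg_push hstack]
      have hlist : seg (s₀.natArr 5) (s'.natReg 5) (s₀.natArr 4 v) ++
          seg (s'.natArr 5) (s₀.natReg 4) (s'.natReg 6) =
          seg (s₀.natArr 5) (s.natReg 5) (s₀.natArr 4 v) ++
          seg (s.natArr 5) (s₀.natReg 4) (s.natReg 6) := by
        rw [hst, hseg, e5]
        simp [hX]
      refine ⟨2 * (s₀.natArr 4 v - (s.natReg 5 + 1)) + (s.natReg 6 + 1 - s₀.natReg 4),
        by omega, ?_⟩
      constructor
      · refine ⟨fun r hr => ?_, fun c h1 h2 => ?_, fun c h1 h2 => ?_, fun i hi => ?_,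
          fun c h1 h2 => ?_, fun hu => ?_⟩
        · rw [← hf.natReg r hr]
          have h5 : r ≠ 5 := by omega
          have h6 : r ≠ 6 := by omega
          simp [hs', h5, h6]
        · rw [← hf.natArr c h1 h2]
          simp [hs', h1]
        · rw [← hf.realArr c h1 h2]
          simp [hs']
        · rw [eM, Function.update_of_ne (by omega), hf.mem i hi]
        · rw [hblk, hptr]
          exact hf.block c h1 h2
        · rw [hptr]
          exact hf.ptr_lt hu
      · rw [e5]; omega
      · rw [e5]; omega
      · rw [e6]; omega
      · rw [e5, e6]
      · rw [hlist]; exact hnd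
      · rw [hlist, hptr]; exact hmem
      · rw [hlist, hblk]; exact hrep
      · rw [hst, hblk, List.map_cons]
        rcases Nat.lt_or_ge (s₀.natReg 4) (s.natReg 6) with h1 | h1
        · simp only [Test.Holds, NatExpr.eval, RealExpr.eval, ha, h4, not_lt, not_and, not_le] at hc
          rw [seg_top h1] at hiron ⊢
          -- The failed test is the ironing inequality between `a` and the old top.
          exact List.isChain_cons_cons.2 ⟨(hc h1).le, hiron⟩
        · have : s.natReg 6 = s₀.natReg 4 := by omega
          rw [this]
          simp [Block.Ironed]
    apply hfl
    simp [NatExpr.eval, ha, hs']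

theorem iron_within {n : ℕ} {F : Finset (Fin n) → ℝ → ℝ} {U : Finset (Fin n)} {s : State} {v : ℕ}
    (hv : s.natReg 3 = v) (hlo : s.natArr 3 v ≤ s.natArr 4 v) (hhi : s.natArr 4 v ≤ s.natReg 4)
    (hlt : ∀ c ∈ reps s v, c < n) (hfix : ∀ c ∈ reps s v, s.natArr 6 c = c)
    (hnd : (reps s v).Nodup) (hrep : Represents F U ((reps s v).map (block n s))) :
    Within iron s (ironBody.flatCost * (2 * n + 1) + 20 * n + 20) fun s' =>
      Frame n (reps s v) s s' ∧ s.natReg 4 ≤ s'.natReg 6 ∧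
      (seg (s'.natArr 5) (s.natReg 4) (s'.natReg 6)).Nodup ∧
      (∀ c ∈ seg (s'.natArr 5) (s.natReg 4) (s'.natReg 6), c ∈ reps s v ∧ s'.natArr 6 c = c) ∧
      Represents F U ((seg (s'.natArr 5) (s.natReg 4) (s'.natReg 6)).map (block n s')) ∧
      Block.Ironed ((seg (s'.natArr 5) (s.natReg 4) (s'.natReg 6)).map (block n s')) := by
  have hlen : s.natArr 4 v - s.natArr 3 v ≤ n := by
    have h1 : (reps s v).toFinset ⊆ Finset.range n := by
      intro c hc
      exact Finset.mem_range.2 (hlt c (by simpa using hc))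
    have h2 := Finset.card_le_card h1
    rw [List.toFinset_card_of_nodup hnd] at h2
    simpa [reps] using h2
  refine (Within.flat_seq (by simp [Prog.Flat]) (Within.flat_loop
    (by simp [ironBody, Prog.Flat]) (IronInv n F U s v)
    (fun m s' h hb => ironInv_step hv hhi hlt h hb)
    (m := 2 * (s.natArr 4 v - s.natArr 3 v)) ?_)).mono ?_ ?_
  · set s' := (s.setNat 5 (s.natArr 3 v)).setNat 6 (s.natReg 4) with hs'
    have : (Prog.seq (.setNat 5 (.get 3 (.reg 3))) (.setNat 6 (.reg 4))).flat s = s' := by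
      simp [Prog.flat, NatExpr.eval, hs', hv]
    rw [this]
    have hblk : block n s' = block n s := by
      funext c
      simp [block, hs']
    have e5 : s'.natReg 5 = s.natArr 3 v := by simp [hs']
    have e6 : s'.natReg 6 = s.natReg 4 := by simp [hs']
    have eM : s'.natArr = s.natArr := by simp [hs']
    constructor
    · refine ⟨fun r hr => ?_, fun c h1 h2 => by rw [eM], fun c h1 h2 => by simp [hs'],
        fun i hi => by rw [eM], fun c h1 h2 => by rw [hblk, eM]; exact ⟨rfl, h2⟩,
        fun hu => by rwa [eM]⟩
      have h5 : r ≠ 5 := by omega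
      have h6 : r ≠ 6 := by omega
      simp [hs', h5, h6]
    · rw [e5]
    · rwa [e5]
    · rw [e6]
    · rw [e5, e6]; omega
    all_goals rw [e6, seg_self]
    · rw [e5, List.append_nil]; exact hnd
    · rw [e5, List.append_nil, eM]; exact fun c hc => ⟨hc, hfix c hc⟩
    · rw [e5, List.append_nil, hblk]; exact hrep
    · simp [Block.Ironed]
  · simp only [Test.cost, NatExpr.cost, Prog.flatCost]
    have : 2 * (s.natArr 4 v - s.natArr 3 v) ≤ 2 * n := by omega
    generalize 2 * (s.natArr 4 v - s.natArr 3 v) = k at this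
    nlinarith
  · rintro s' ⟨⟨m, h⟩, hb⟩
    have hi : s'.natReg 5 = s.natArr 4 v := by
      refine le_antisymm h.high ?_
      simpa [Test.Holds, NatExpr.eval, h.frame.natReg 3 (by norm_num),
        h.frame.natArr 4 (by norm_num) (by norm_num), hv] using hb
    have h1 := h.nodup
    have h2 := h.mem
    have h3 := h.represents
    rw [hi, seg_self, List.nil_append] at h1 h2 h3
    exact ⟨h.frame, h.stack, h1, h2, h3, h.ironed⟩

end RealRAM

/-! ### Charging an edge and merging with the list of the parent -/

namespace RealRAM

open PPTPT

theorem length_le_of_nodup {L : List ℕ} {n : ℕ} (hnd : L.Nodup) (hlt : ∀ c ∈ L, c < n) :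
    L.length ≤ n := by
  have h1 : L.toFinset ⊆ Finset.range n := by
    intro c hc
    exact Finset.mem_range.2 (hlt c (by simpa using hc))
  have h2 := Finset.card_le_card h1
  rw [List.toFinset_card_of_nodup hnd] at h2
  simpa using h2

/-- Charge the next block, or cut the list. -/
def chargeBody : Prog :=
  let a : NatExpr := .get 5 (.sub (.reg 5) (.const 1))
  .ite (.realLt (.get 1 a) (.reg 0)) (.setNat 7 (.reg 5))
    (.seq (.putReal 1 a (.sub (.get 1 a) (.reg 0)))
      (.seq (.setReal 0 (.mul (.reg 0) (.get 2 a))) (.setNat 5 (.sub (.reg 5) (.const 1)))))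

/-- Charge the edge above the current node to the blocks of its list. -/
def charge : Prog :=
  .seq (.seq (.setNat 5 (.reg 6)) (.seq (.setNat 7 (.reg 4)) (.setReal 0 (.get 0 (.reg 3)))))
    (.loop (.natLt (.reg 7) (.reg 5)) chargeBody)

/-- The blocks at the addresses `seg M i top` are charged, those at `seg M lo i` are not. -/
structure ChargeInv (n : ℕ) (s₀ : State) (m : ℕ) (s : State) : Prop where
  frame : Frame n (seg (s₀.natArr 5) (s₀.natReg 4) (s₀.natReg 6)) s₀ s
  natArr : s.natArr = s₀.natArr
  top : s.natReg 6 = s₀.natReg 6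
  low : s₀.natReg 4 ≤ s.natReg 7
  mid : s.natReg 7 ≤ s.natReg 5
  high : s.natReg 5 ≤ s₀.natReg 6
  measure : m = s.natReg 5 - s.natReg 7
  same : ∀ c ∈ seg (s₀.natArr 5) (s.natReg 7) (s.natReg 5), block n s c = block n s₀ c
  shift : Block.shift (s₀.realArr 0 (s₀.natReg 3))
    ((seg (s₀.natArr 5) (s₀.natReg 4) (s₀.natReg 6)).map (block n s₀)) =
      (seg (s₀.natArr 5) (s.natReg 5) (s₀.natReg 6)).map (block n s) ++
      Block.shift (s.realReg 0) ((seg (s₀.natArr 5) (s.natReg 7) (s.natReg 5)).map (block n s₀))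

/-- The walk starts at the head, on top, and real register `0` carries the edge length times the
idle probabilities already passed. A cut raises the lower bound to the current position, which also
ends the loop. -/
theorem chargeInv_step {n : ℕ} {s₀ : State}
    (hnd : (seg (s₀.natArr 5) (s₀.natReg 4) (s₀.natReg 6)).Nodup) {m : ℕ} {s : State}
    (h : ChargeInv n s₀ m s) (hb : (Test.natLt (.reg 7) (.reg 5)).Holds s) :
    ∃ m' < m, ChargeInv n s₀ m' (chargeBody.flat s) := by
  obtain ⟨hf, hA, ht, hlow, hmid, hhigh, rfl, hsame, hshift⟩ := h
  have hi : s.natReg 7 < s.natReg 5 := by simpa [Test.Holds, NatExpr.eval] using hb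
  have htop := seg_top (M := s₀.natArr 5) hi
  set a := s₀.natArr 5 (s.natReg 5 - 1) with ha_def
  have ha : s.natArr 5 (s.natReg 5 - 1) = a := by rw [hA]
  have hba : block n s a = block n s₀ a := hsame a (by rw [htop]; simp)
  have hpa : s₀.realArr 1 a = s.realArr 1 a := (congrArg Block.price hba).symm
  have hia : s₀.realArr 2 a = s.realArr 2 a := (congrArg Block.idle hba).symm
  simp only [chargeBody, Prog.flat]
  split_ifs with hc
  · simp only [Test.Holds, RealExpr.eval, NatExpr.eval, ha] at hc
    set s' := s.setNat 7 (s.natReg 5) with hs'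
    have hfl : ∀ t, t = s' → ∃ m' < s.natReg 5 - s.natReg 7, ChargeInv n s₀ m' t := by
      rintro _ rfl
      have e5 : s'.natReg 5 = s.natReg 5 := by simp [hs']
      have e7 : s'.natReg 7 = s.natReg 5 := by simp [hs']
      have hblk : block n s' = block n s := by
        funext c
        simp [block, hs']
      have hlt : ∀ r < 5, s'.natReg r = s.natReg r := by
        intro r hr
        have h7 : r ≠ 7 := by omega
        simp [hs', h7]
      refine ⟨0, by omega, ⟨fun r hr => (hlt r hr).trans (hf.natReg r hr), hf.2, hf.3, hf.4, ?_,
        hf.6⟩, hA, by simpa [hs'] using ht, by omega, by omega, by omega, by omega, ?_, ?_⟩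
      · rw [hblk]
        exact hf.block
      · rw [e5, e7, seg_self]
        simp
      · rw [e5, e7, seg_self, hblk, hshift, htop, List.map_cons]
        have : (block n s₀ a).price < s.realReg 0 := by rw [← hba]; exact hc
        simp [Block.shift, this]
    exact hfl _ (by simp [NatExpr.eval, hs'])
  · simp only [Test.Holds, RealExpr.eval, NatExpr.eval, ha] at hc
    set s' := ((s.putReal 1 a (s.realArr 1 a - s.realReg 0)).setReal 0
      (s.realReg 0 * s.realArr 2 a)).setNat 5 (s.natReg 5 - 1) with hs'
    have hfl : ∀ t, t = s' → ∃ m' < s.natReg 5 - s.natReg 7, ChargeInv n s₀ m' t := by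
      rintro _ rfl
      have e5 : s'.natReg 5 = s.natReg 5 - 1 := by simp [hs']
      have e7 : s'.natReg 7 = s.natReg 7 := by simp [hs']
      have hlt : ∀ r < 5, s'.natReg r = s.natReg r := by
        intro r hr
        have h7 : r ≠ 5 := by omega
        simp [hs', h7]
      have hblk : ∀ c, c ≠ a → block n s' c = block n s c := by
        intro c hc
        simp [block, hs', hc]
      have hblka : block n s' a = ⟨(block n s₀ a).price - s.realReg 0, (block n s₀ a).idle,
          (block n s₀ a).nodes⟩ := by
        rw [← hba]
        simp [block, hs']
      have hsplit := seg_append (M := s₀.natArr 5) (hlow.trans hmid) hhigh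
      have hsplit' := seg_append (M := s₀.natArr 5) hlow hmid
      rw [hsplit, hsplit', htop] at hnd
      have haL : a ∈ seg (s₀.natArr 5) (s₀.natReg 4) (s₀.natReg 6) := by
        rw [hsplit, hsplit', htop]
        simp
      refine ⟨s.natReg 5 - 1 - s.natReg 7, by omega,
        ⟨fun r hr => (hlt r hr).trans (hf.natReg r hr), hf.natArr, fun c h1 h2 => ?_, hf.mem,
        fun c h1 h2 => ?_, hf.ptr_lt⟩, hA, by simpa [hs'] using ht, by omega, by omega, by omega,
        by omega, fun c hc => ?_, ?_⟩
      · rw [← hf.realArr c h1 h2]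
        simp [hs', h1]
      · rw [hblk c (by rintro rfl; exact h1 haL)]
        exact hf.block c h1 h2
      · rw [e5, e7] at hc
        rw [hblk c, hsame c (by rw [htop]; simp [hc])]
        rintro rfl
        simp [List.nodup_append] at hnd
        grind
      · have hbot := seg_bot (M := s₀.natArr 5) (lo := s.natReg 5 - 1) (hi := s₀.natReg 6)
          (by omega)
        rw [Nat.sub_add_cancel (by omega)] at hbot
        rw [e5, e7, hshift, hbot, htop]
        have hm : (seg (s₀.natArr 5) (s.natReg 5) (s₀.natReg 6)).map (block n s') =
            (seg (s₀.natArr 5) (s.natReg 5) (s₀.natReg 6)).map (block n s) := by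
          refine List.map_congr_left fun c hc => hblk c ?_
          rintro rfl
          simp [List.nodup_append] at hnd
          grind
        have hnc : ¬ (block n s₀ a).price < s.realReg 0 := by rw [← hba]; exact hc
        have hx : s'.realReg 0 = s.realReg 0 * (block n s₀ a).idle := by
          simp [hs', block, hia]
        rw [List.map_append, hm, List.map_cons, Block.shift, if_neg hnc, hx, ← ha_def]
        simp [hblka]
    apply hfl
    simp [NatExpr.eval, RealExpr.eval, hs', ha]

theorem charge_within {n : ℕ} {s : State}
    (hnd : (seg (s.natArr 5) (s.natReg 4) (s.natReg 6)).Nodup)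
    (hlt : ∀ c ∈ seg (s.natArr 5) (s.natReg 4) (s.natReg 6), c < n)
    (hle : s.natReg 4 ≤ s.natReg 6) :
    Within charge s (chargeBody.flatCost * n + 20 * n + 20) fun s' =>
      Frame n (seg (s.natArr 5) (s.natReg 4) (s.natReg 6)) s s' ∧ s'.natArr = s.natArr ∧
      s'.natReg 6 = s.natReg 6 ∧ s.natReg 4 ≤ s'.natReg 7 ∧ s'.natReg 7 ≤ s.natReg 6 ∧
      (seg (s.natArr 5) (s'.natReg 7) (s.natReg 6)).map (block n s') =
        Block.shift (s.realArr 0 (s.natReg 3))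
          ((seg (s.natArr 5) (s.natReg 4) (s.natReg 6)).map (block n s)) := by
  have hlen := length_le_of_nodup hnd hlt
  rw [length_seg] at hlen
  refine (Within.flat_seq (by simp [Prog.Flat]) (Within.flat_loop
    (by simp [chargeBody, Prog.Flat]) (ChargeInv n s)
    (fun m s' h hb => chargeInv_step hnd h hb)
    (m := s.natReg 6 - s.natReg 4) ?_)).mono ?_ ?_
  · set s' := ((s.setNat 5 (s.natReg 6)).setNat 7 (s.natReg 4)).setReal 0
      (s.realArr 0 (s.natReg 3)) with hs'
    have : (Prog.seq (.setNat 5 (.reg 6)) (.seq (.setNat 7 (.reg 4))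
        (.setReal 0 (.get 0 (.reg 3))))).flat s = s' := by
      simp [Prog.flat, NatExpr.eval, RealExpr.eval, hs']
    rw [this]
    have hblk : block n s' = block n s := by
      funext c
      simp [block, hs']
    have e5 : s'.natReg 5 = s.natReg 6 := by simp [hs']
    have e6 : s'.natReg 6 = s.natReg 6 := by simp [hs']
    have e7 : s'.natReg 7 = s.natReg 4 := by simp [hs']
    have eM : s'.natArr = s.natArr := by simp [hs']
    constructor
    · refine ⟨fun r hr => ?_, fun c h1 h2 => by rw [eM], fun c h1 h2 => by simp [hs'],
        fun i hi => by rw [eM], fun c h1 h2 => by rw [hblk, eM]; exact ⟨rfl, h2⟩,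
        fun hu => by rwa [eM]⟩
      have h5 : r ≠ 5 := by omega
      have h6 : r ≠ 7 := by omega
      simp [hs', h5, h6]
    · exact eM
    · exact e6
    · omega
    · omega
    · omega
    · omega
    · exact fun c _ => by rw [hblk]
    · rw [e5, e7, seg_self]
      simp [hs']
  · simp only [Test.cost, NatExpr.cost, RealExpr.cost, Prog.flatCost]
    generalize s.natReg 6 - s.natReg 4 = k at hlen
    nlinarith
  · rintro s' ⟨⟨m, h⟩, hb⟩
    have hi : s'.natReg 5 = s'.natReg 7 := by
      refine le_antisymm ?_ h.mid
      simpa [Test.Holds, NatExpr.eval] using hb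
    have h1 := h.shift
    rw [hi, seg_self] at h1
    refine ⟨h.frame, h.natArr, h.top, h.low, hi ▸ h.high, ?_⟩
    rw [h1]
    simp [Block.shift]

/-- Append the smaller of the two next blocks to the merged list. -/
def mergeBody : Prog :=
  .seq (.ite (.and (.natLt (.reg 5) (.reg 6)) (.neg (.and (.natLt (.reg 8) (.get 4 (.reg 10)))
        (.realLt (.get 1 (.get 5 (.reg 8))) (.get 1 (.get 5 (.reg 5)))))))
      (.seq (.putNat 5 (.reg 11) (.get 5 (.reg 5))) (.setNat 5 (.add (.reg 5) (.const 1))))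
      (.seq (.putNat 5 (.reg 11) (.get 5 (.reg 8))) (.setNat 8 (.add (.reg 8) (.const 1)))))
    (.setNat 11 (.add (.reg 11) (.const 1)))

/-- Merge the charged list of the current node with the list of its parent. -/
def merge : Prog :=
  .seq (.seq (.setNat 10 (.get 0 (.reg 3))) (.seq (.setNat 5 (.reg 7))
      (.seq (.setNat 8 (.get 3 (.reg 10))) (.setNat 11 (.reg 6)))))
    (.loop (.neg (.and (.neg (.natLt (.reg 5) (.reg 6)))
      (.neg (.natLt (.reg 8) (.get 4 (.reg 10)))))) mergeBody)

/-- The memory beyond the address `top` holds the merge of `seg M lo i` and `seg M lo' j`. -/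
structure MergeInv (n : ℕ) (s₀ : State) (p : ℕ) (m : ℕ) (s : State) : Prop where
  frame : Frame n [] s₀ s
  block : RealRAM.block n s = RealRAM.block n s₀
  ptr : s.natArr 6 = s₀.natArr 6
  parent : s.natReg 10 = p
  top : s.natReg 6 = s₀.natReg 6
  memory : ∀ i < s₀.natReg 6, s.natArr 5 i = s₀.natArr 5 i
  left : s₀.natReg 7 ≤ s.natReg 5
  left_le : s.natReg 5 ≤ s₀.natReg 6
  right : s₀.natArr 3 p ≤ s.natReg 8
  right_le : s.natReg 8 ≤ s₀.natArr 4 p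
  out : s₀.natReg 6 ≤ s.natReg 11
  measure : m = (s₀.natReg 6 - s.natReg 5) + (s₀.natArr 4 p - s.natReg 8)
  perm : (seg (s.natArr 5) (s₀.natReg 6) (s.natReg 11)).Perm
    (seg (s₀.natArr 5) (s₀.natReg 7) (s.natReg 5) ++
      seg (s₀.natArr 5) (s₀.natArr 3 p) (s.natReg 8))
  sorted : ∀ a ∈ seg (s₀.natArr 5) (s₀.natReg 7) (s.natReg 5) ++
      seg (s₀.natArr 5) (s₀.natArr 3 p) (s.natReg 8),
    ∀ b ∈ seg (s₀.natArr 5) (s.natReg 5) (s₀.natReg 6) ++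
      seg (s₀.natArr 5) (s.natReg 8) (s₀.natArr 4 p), s₀.realArr 1 a ≤ s₀.realArr 1 b
  merge : Block.Merge ((seg (s₀.natArr 5) (s₀.natReg 7) (s.natReg 5)).map (RealRAM.block n s₀))
    ((seg (s₀.natArr 5) (s₀.natArr 3 p) (s.natReg 8)).map (RealRAM.block n s₀))
    ((seg (s.natArr 5) (s₀.natReg 6) (s.natReg 11)).map (RealRAM.block n s₀))

/-- Keys do not decrease with the address, so the next cell to be read holds a cheapest remaining
block. -/
theorem le_of_pairwise_seg {M : ℕ → ℕ} {K : ℕ → ℝ} {lo hi i : ℕ}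
    (h : (seg M lo hi).Pairwise fun a b => K b ≤ K a) (h1 : lo ≤ i) (h2 : i < hi) :
    ∀ b ∈ seg M (i + 1) hi, K (M i) ≤ K b := by
  rw [seg_append h1 h2.le, seg_bot h2, List.append_assoc, List.pairwise_append] at h
  exact fun b hb => h.2.2 b hb _ (by simp)

/-- Both lists are read from their cheap ends. The new block is at least as dear as everything
already written, which is the side condition for putting it at the head of a `Merge`. -/
theorem mergeInv_step {n : ℕ} {s₀ : State} {p : ℕ} (hle : s₀.natReg 4 ≤ s₀.natReg 6)
    (hp : s₀.natArr 4 p ≤ s₀.natReg 4)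
    (hA : (seg (s₀.natArr 5) (s₀.natReg 7) (s₀.natReg 6)).Pairwise
      fun a b => s₀.realArr 1 b ≤ s₀.realArr 1 a)
    (hB : (seg (s₀.natArr 5) (s₀.natArr 3 p) (s₀.natArr 4 p)).Pairwise
      fun a b => s₀.realArr 1 b ≤ s₀.realArr 1 a) {m : ℕ} {s : State} (h : MergeInv n s₀ p m s)
    (hb : (Test.neg (.and (.neg (.natLt (.reg 5) (.reg 6)))
      (.neg (.natLt (.reg 8) (.get 4 (.reg 10)))))).Holds s) :
    ∃ m' < m, MergeInv n s₀ p m' (mergeBody.flat s) := by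
  obtain ⟨hf, hblk, hptr, hpar, htop, hM, hl, hll, hr, hrl, ho, rfl, hperm, hs, hm⟩ := h
  have h4 : s.natArr 4 = s₀.natArr 4 := hf.natArr 4 (by norm_num) (by norm_num)
  have hK : s.realArr 1 = s₀.realArr 1 := by
    funext c
    exact congrArg Block.price (congrFun hblk c)
  simp only [Test.Holds, NatExpr.eval, hpar, htop, h4, not_and_or, not_not] at hb
  -- Either branch writes a single cell above both input lists, so these lists, the blocks and the
  -- pointers survive.
  have common : ∀ (s' : State), (∀ r < 5, s'.natReg r = s.natReg r) →
      ∀ c, s'.natArr = Function.update s.natArr 5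
        (Function.update (s.natArr 5) (s.natReg 11) c) → s'.realArr = s.realArr →
      s'.natReg 11 = s.natReg 11 + 1 →
      Frame n [] s₀ s' ∧ RealRAM.block n s' = RealRAM.block n s₀ ∧ s'.natArr 6 = s₀.natArr 6 ∧
      (∀ i < s₀.natReg 6, s'.natArr 5 i = s₀.natArr 5 i) ∧
      seg (s'.natArr 5) (s₀.natReg 6) (s'.natReg 11) =
        c :: seg (s.natArr 5) (s₀.natReg 6) (s.natReg 11) := by
    intro s' h1 c h2 h3 h11
    have e6 : s'.natArr 6 = s.natArr 6 := by rw [h2]; simp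
    have e5 : s'.natArr 5 = Function.update (s.natArr 5) (s.natReg 11) c := by rw [h2]; simp
    have hblk' : RealRAM.block n s' = RealRAM.block n s₀ := by
      rw [← hblk]
      funext c
      simp [RealRAM.block, h3, e6]
    refine ⟨⟨fun r hr => (h1 r hr).trans (hf.natReg r hr), fun a ha ha' => ?_, fun a ha ha' => ?_,
      fun i hi => ?_, fun c hc hc' => ?_, ?_⟩, hblk', by rw [e6, hptr], fun i hi => ?_, ?_⟩
    · rw [← hf.natArr a ha ha', h2, Function.update_of_ne ha]
    · rw [← hf.realArr a ha ha', h3]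
    · rw [e5, Function.update_of_ne (by omega), hf.mem i hi]
    · rw [hblk', e6, hptr]
      exact ⟨rfl, hc'⟩
    · rw [e6]
      exact hf.ptr_lt
    · rw [e5, Function.update_of_ne (by omega), hM i hi]
    · rw [e5, h11, seg_push ho]
  simp only [mergeBody, Prog.flat]
  split_ifs with hc
  · simp only [Test.Holds, NatExpr.eval, RealExpr.eval, hpar, htop, h4, not_and, not_lt] at hc
    obtain ⟨hi, hc⟩ := hc
    have hMi : s.natArr 5 (s.natReg 5) = s₀.natArr 5 (s.natReg 5) := hM _ hi
    set a := s₀.natArr 5 (s.natReg 5) with ha_def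
    have hfl : ∀ s', s' = ((s.putNat 5 (s.natReg 11) a).setNat 5 (s.natReg 5 + 1)).setNat 11
        (s.natReg 11 + 1) → ∃ m' < s₀.natReg 6 - s.natReg 5 + (s₀.natArr 4 p - s.natReg 8),
        MergeInv n s₀ p m' s' := by
      intro s' hs'
      have e5 : s'.natReg 5 = s.natReg 5 + 1 := by simp [hs']
      have e8 : s'.natReg 8 = s.natReg 8 := by simp [hs']
      have e11 : s'.natReg 11 = s.natReg 11 + 1 := by simp [hs']
      obtain ⟨c1, c2, c3, c4, c5⟩ := common s' (fun r hr => by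
        have h5 : r ≠ 5 := by omega
        have h11 : r ≠ 11 := by omega
        simp [hs', h5, h11]) a (by simp [hs']) (by simp [hs']) e11
      have hrest := seg_bot (M := s₀.natArr 5) hi
      have hnext := seg_succ (M := s₀.natArr 5) hl
      rw [← ha_def] at hrest hnext
      refine ⟨s₀.natReg 6 - (s.natReg 5 + 1) + (s₀.natArr 4 p - s.natReg 8), by omega, c1, c2, c3,
        by simp [hs', hpar], by simp [hs', htop], c4, by omega, by omega, by omega, by omega,
        by omega, by rw [e5, e8], ?_, ?_, ?_⟩
      · rw [c5, e5, e8, hnext]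
        exact hperm.cons a
      · rw [e5, e8, hnext]
        rw [hrest] at hs
        have hmin : ∀ b ∈ seg (s₀.natArr 5) (s.natReg 5 + 1) (s₀.natReg 6) ++
            seg (s₀.natArr 5) (s.natReg 8) (s₀.natArr 4 p),
            s₀.realArr 1 a ≤ s₀.realArr 1 b := by
          intro b hb
          rcases List.mem_append.1 hb with hb | hb
          · exact le_of_pairwise_seg hA hl hi b hb
          · have hj : s.natReg 8 < s₀.natArr 4 p := by
              obtain ⟨k, h1, h2, -⟩ := mem_seg.1 hb
              omega
            have h1 := hc hj
            rw [hMi, hM _ (by omega), hK] at h1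
            rw [seg_bot hj] at hb
            rcases List.mem_append.1 hb with hb | hb
            · exact h1.trans (le_of_pairwise_seg hB hr hj b hb)
            · rw [List.mem_singleton.1 hb]
              exact h1
        intro c hc b hb
        rcases List.mem_append.1 hc with hc | hc
        · rcases List.mem_cons.1 hc with rfl | hc
          · exact hmin b hb
          · exact hs c (by simp [hc]) b (by simp at hb ⊢; tauto)
        · exact hs c (by simp [hc]) b (by simp at hb ⊢; tauto)
      · rw [c5, e5, e8, hnext]
        refine Block.Merge.left _ hm ?_
        simp only [List.mem_map, forall_exists_index, and_imp, forall_apply_eq_imp_iff₂]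
        exact fun b hb => hs b (by simp [hb]) a (by rw [hrest]; simp)
    apply hfl
    simp [NatExpr.eval, hMi]
  · simp only [Test.Holds, NatExpr.eval, RealExpr.eval, hpar, htop, h4, not_and, not_lt,
      not_forall, not_le] at hc
    have hj : s.natReg 8 < s₀.natArr 4 p := by
      rcases hb with hb | hb
      · exact (hc hb).1
      · exact hb
    have hMj : s.natArr 5 (s.natReg 8) = s₀.natArr 5 (s.natReg 8) := hM _ (by omega)
    set a := s₀.natArr 5 (s.natReg 8) with ha_def
    have hfl : ∀ s', s' = ((s.putNat 5 (s.natReg 11) a).setNat 8 (s.natReg 8 + 1)).setNat 11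
        (s.natReg 11 + 1) → ∃ m' < s₀.natReg 6 - s.natReg 5 + (s₀.natArr 4 p - s.natReg 8),
        MergeInv n s₀ p m' s' := by
      intro s' hs'
      have e5 : s'.natReg 5 = s.natReg 5 := by simp [hs']
      have e8 : s'.natReg 8 = s.natReg 8 + 1 := by simp [hs']
      have e11 : s'.natReg 11 = s.natReg 11 + 1 := by simp [hs']
      obtain ⟨c1, c2, c3, c4, c5⟩ := common s' (fun r hr => by
        have h5 : r ≠ 8 := by omega
        have h11 : r ≠ 11 := by omega
        simp [hs', h5, h11]) a (by simp [hs']) (by simp [hs']) e11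
      have hrest := seg_bot (M := s₀.natArr 5) hj
      have hnext := seg_succ (M := s₀.natArr 5) hr
      rw [← ha_def] at hrest hnext
      refine ⟨s₀.natReg 6 - s.natReg 5 + (s₀.natArr 4 p - (s.natReg 8 + 1)), by omega, c1, c2, c3,
        by simp [hs', hpar], by simp [hs', htop], c4, by omega, by omega, by omega, by omega,
        by omega, by rw [e5, e8], ?_, ?_, ?_⟩
      · rw [c5, e5, e8, hnext]
        exact (hperm.cons a).trans List.perm_middle.symm
      · rw [e5, e8, hnext]
        rw [hrest] at hs
        have hmin : ∀ b ∈ seg (s₀.natArr 5) (s.natReg 5) (s₀.natReg 6) ++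
            seg (s₀.natArr 5) (s.natReg 8 + 1) (s₀.natArr 4 p),
            s₀.realArr 1 a ≤ s₀.realArr 1 b := by
          intro b hb
          rcases List.mem_append.1 hb with hb | hb
          · have hi : s.natReg 5 < s₀.natReg 6 := by
              obtain ⟨k, h1, h2, -⟩ := mem_seg.1 hb
              omega
            have h1 := (hc hi).2.le
            rw [hMj, hM _ hi, hK] at h1
            rw [seg_bot hi] at hb
            rcases List.mem_append.1 hb with hb | hb
            · exact h1.trans (le_of_pairwise_seg hA hl hi b hb)
            · rw [List.mem_singleton.1 hb]
              exact h1
          · exact le_of_pairwise_seg hB hr hj b hb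
        intro c hc b hb
        rcases List.mem_append.1 hc with hc | hc
        · exact hs c (by simp [hc]) b (by simp at hb ⊢; tauto)
        · rcases List.mem_cons.1 hc with rfl | hc
          · exact hmin b hb
          · exact hs c (by simp [hc]) b (by simp at hb ⊢; tauto)
      · rw [c5, e5, e8, hnext]
        refine Block.Merge.right _ hm ?_
        simp only [List.mem_map, forall_exists_index, and_imp, forall_apply_eq_imp_iff₂]
        exact fun b hb => hs b (by simp [hb]) a (by rw [hrest]; simp)
    apply hfl
    simp [NatExpr.eval, hMj]

theorem merge_within {n : ℕ} {s : State} {p : ℕ} (hpar : s.natArr 0 (s.natReg 3) = p)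
    (hle : s.natReg 4 ≤ s.natReg 6) (h7 : s.natReg 7 ≤ s.natReg 6)
    (h34 : s.natArr 3 p ≤ s.natArr 4 p) (hp : s.natArr 4 p ≤ s.natReg 4)
    (hA : (seg (s.natArr 5) (s.natReg 7) (s.natReg 6)).Pairwise
      fun a b => s.realArr 1 b ≤ s.realArr 1 a)
    (hB : (reps s p).Pairwise fun a b => s.realArr 1 b ≤ s.realArr 1 a)
    (hnd : (seg (s.natArr 5) (s.natReg 7) (s.natReg 6) ++ reps s p).Nodup)
    (hlt : ∀ c ∈ seg (s.natArr 5) (s.natReg 7) (s.natReg 6) ++ reps s p, c < n) :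
    Within merge s (mergeBody.flatCost * n + 50 * n + 50) fun s' =>
      Frame n [] s s' ∧ block n s' = block n s ∧ s'.natArr 6 = s.natArr 6 ∧ s'.natReg 10 = p ∧
      s'.natReg 6 = s.natReg 6 ∧ s.natReg 6 ≤ s'.natReg 11 ∧
      (seg (s'.natArr 5) (s.natReg 6) (s'.natReg 11)).Perm
        (seg (s.natArr 5) (s.natReg 7) (s.natReg 6) ++ reps s p) ∧
      Block.Merge ((seg (s.natArr 5) (s.natReg 7) (s.natReg 6)).map (block n s))
        ((reps s p).map (block n s))
        ((seg (s'.natArr 5) (s.natReg 6) (s'.natReg 11)).map (block n s)) := by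
  have hlen := length_le_of_nodup hnd hlt
  rw [List.length_append, reps, length_seg, length_seg] at hlen
  refine (Within.flat_seq (by simp [Prog.Flat]) (Within.flat_loop
    (by simp [mergeBody, Prog.Flat]) (MergeInv n s p)
    (fun m s' h hb => mergeInv_step hle hp hA hB h hb)
    (m := (s.natReg 6 - s.natReg 7) + (s.natArr 4 p - s.natArr 3 p)) ?_)).mono ?_ ?_
  · set s' := (((s.setNat 10 p).setNat 5 (s.natReg 7)).setNat 8 (s.natArr 3 p)).setNat 11
      (s.natReg 6) with hs'
    have : (Prog.seq (.setNat 10 (.get 0 (.reg 3))) (.seq (.setNat 5 (.reg 7))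
      (.seq (.setNat 8 (.get 3 (.reg 10))) (.setNat 11 (.reg 6))))).flat s = s' := by
      simp [Prog.flat, NatExpr.eval, hs', hpar]
    rw [this]
    have hblk : block n s' = block n s := by
      funext c
      simp [block, hs']
    have e5 : s'.natReg 5 = s.natReg 7 := by simp [hs']
    have e8 : s'.natReg 8 = s.natArr 3 p := by simp [hs']
    have e6 : s'.natReg 6 = s.natReg 6 := by simp [hs']
    have e11 : s'.natReg 11 = s.natReg 6 := by simp [hs']
    have eM : s'.natArr = s.natArr := by simp [hs']
    refine ⟨?_, hblk, by rw [eM], by simp [hs'], e6, fun i _ => by rw [eM], by omega, by omega,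
      by omega, by omega, by omega, by omega, ?_, ?_, ?_⟩
    · refine ⟨fun r hr => ?_, fun c h1 h2 => by rw [eM], fun c h1 h2 => by simp [hs'],
        fun i hi => by rw [eM], fun c h1 h2 => by rw [hblk, eM]; exact ⟨rfl, h2⟩,
        fun hu => by rwa [eM]⟩
      have h5 : r ≠ 5 := by omega
      have h8 : r ≠ 8 := by omega
      have h10 : r ≠ 10 := by omega
      have h11 : r ≠ 11 := by omega
      simp [hs', h5, h8, h10, h11]
    · rw [e5, e8, e11]
      simp
    · rw [e5, e8]
      simp
    · rw [e5, e8, e11]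
      simpa using Block.Merge.nil
  · simp only [Test.cost, NatExpr.cost, Prog.flatCost]
    generalize s.natReg 6 - s.natReg 7 + (s.natArr 4 p - s.natArr 3 p) = k at hlen
    nlinarith
  · rintro s' ⟨⟨m, h⟩, hb⟩
    simp only [Test.Holds, NatExpr.eval, h.parent, h.top,
      h.frame.natArr 4 (by norm_num) (by norm_num), not_not, not_lt] at hb
    have h5 : s'.natReg 5 = s.natReg 6 := le_antisymm h.left_le hb.1
    have h8 : s'.natReg 8 = s.natArr 4 p := le_antisymm h.right_le hb.2
    have h1 := h.perm
    have h2 := h.merge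
    rw [h5, h8] at h1 h2
    exact ⟨h.frame, h.block, h.ptr, h.parent, h.top, h.out, h1, h2⟩

end RealRAM

/-! ### Absorbing a node into its parent -/

namespace Block

theorem Merge.pairwise {n : ℕ} {A B M : List (Block n)} (h : Merge A B M)
    (hA : A.Pairwise fun a b => b.price ≤ a.price) (hB : B.Pairwise fun a b => b.price ≤ a.price) :
    M.Pairwise fun a b => b.price ≤ a.price := by
  induction h with
  | nil => exact List.Pairwise.nil
  | left a h ha ih =>
    rw [List.pairwise_cons] at hA ⊢
    exact ⟨fun b hb => ((h.mem_iff b).1 hb).elim (hA.1 b) (ha b), ih hA.2 hB⟩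
  | right a h ha ih =>
    rw [List.pairwise_cons] at hB ⊢
    exact ⟨fun b hb => ((h.mem_iff b).1 hb).elim (ha b) (hB.1 b), ih hA hB.2⟩

end Block

namespace RealRAM

open PPTPT

/-- The list of blocks of node `v` is stored below the first free memory cell, is sorted, and
represents the optimal subsets of `U`. -/
structure Stores (n : ℕ) (F : Finset (Fin n) → ℝ → ℝ) (U : Finset (Fin n)) (s : State) (v : ℕ) :
    Prop where
  lo_le : s.natArr 3 v ≤ s.natArr 4 v
  hi_le : s.natArr 4 v ≤ s.natReg 4
  fixed : ∀ c ∈ reps s v, s.natArr 6 c = c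
  mem : ∀ c ∈ reps s v, ∃ u ∈ U, (u : ℕ) = c
  nodup : (reps s v).Nodup
  sorted : (reps s v).Pairwise fun a b => s.realArr 1 b ≤ s.realArr 1 a
  represents : Represents F U ((reps s v).map (block n s))

theorem Stores.lt {n : ℕ} {F : Finset (Fin n) → ℝ → ℝ} {U : Finset (Fin n)} {s : State} {v : ℕ}
    (h : Stores n F U s v) : ∀ c ∈ reps s v, c < n := by
  intro c hc
  obtain ⟨u, -, rfl⟩ := h.mem c hc
  exact u.2

theorem Stores.notMem {n : ℕ} {F F' : Finset (Fin n) → ℝ → ℝ} {U U' : Finset (Fin n)} {s : State}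
    {v w : ℕ} (h : Stores n F U s v) (h' : Stores n F' U' s w) (hU : Disjoint U U') :
    ∀ c ∈ reps s w, c ∉ reps s v := by
  intro c hc hc'
  obtain ⟨u, hu, rfl⟩ := h.mem c hc'
  obtain ⟨u', hu', he⟩ := h'.mem _ hc
  exact Finset.disjoint_left.1 hU hu (Fin.ext he ▸ hu')

theorem Frame.reps_eq {n : ℕ} {L : List ℕ} {s s' : State} (h : Frame n L s s') {w : ℕ}
    (hw : s.natArr 4 w ≤ s.natReg 4) : reps s' w = reps s w := by
  rw [reps, reps, h.natArr 3 (by norm_num) (by norm_num), h.natArr 4 (by norm_num) (by norm_num)]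
  exact seg_congr fun i _ hi => h.mem i (by omega)

/-- The cells of the list lie below the first free cell, and only blocks with representatives in `L`
may change. -/
theorem Stores.frame {n : ℕ} {F : Finset (Fin n) → ℝ → ℝ} {U : Finset (Fin n)} {s s' : State}
    {w : ℕ} {L : List ℕ} (h : Stores n F U s w) (hf : Frame n L s s')
    (hL : ∀ c ∈ reps s w, c ∉ L) : Stores n F U s' w := by
  have hr := hf.reps_eq h.hi_le
  have hb : ∀ c ∈ reps s w, block n s' c = block n s c ∧ s'.natArr 6 c = c :=
    fun c hc => hf.block c (hL c hc) (h.fixed c hc)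
  refine ⟨?_, ?_, ?_, ?_, ?_, ?_, ?_⟩
  · rw [hf.natArr 3 (by norm_num) (by norm_num), hf.natArr 4 (by norm_num) (by norm_num)]
    exact h.lo_le
  · rw [hf.natArr 4 (by norm_num) (by norm_num), hf.natReg 4 (by norm_num)]
    exact h.hi_le
  · rw [hr]
    exact fun c hc => (hb c hc).2
  · rw [hr]; exact h.mem
  · rw [hr]; exact h.nodup
  · rw [hr]
    refine h.sorted.imp_of_mem fun {a b} ha hb' hab => ?_
    have h1 : s'.realArr 1 a = s.realArr 1 a := congrArg Block.price (hb a ha).1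
    have h2 : s'.realArr 1 b = s.realArr 1 b := congrArg Block.price (hb b hb').1
    rwa [h1, h2]
  · rw [hr, List.map_congr_left fun c hc => (hb c hc).1]
    exact h.represents

/-- Iron the list of the current node, charge the edge above it, and merge the result with the list
of the parent. -/
def absorb : Prog := .seq iron (.seq charge merge)

/-- A bound for the number of steps of `absorb`, per node of the tree. -/
def absorbCost : ℕ :=
  3 * ironBody.flatCost + chargeBody.flatCost + mergeBody.flatCost + 180

/-- After ironing, `Represents.shift` and `Represents.insert_edge` account for the edge above `v`,
and `Represents.merge` joins the disjoint node sets. The list of `p` survives the first two phases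
because its representatives lie outside the sub-tree of `v`. -/
theorem absorb_within {n : ℕ} (T : PPTPT n) {s : State} {v p : Fin n} {W U : Finset (Fin n)}
    (hv : s.natReg 3 = v) (hp : s.natArr 0 v = p) (hlen : s.realArr 0 v = T.len v)
    (h0 : 0 ≤ T.len v)
    (hsv : Stores n (T.gain ((T.subtree v).erase v)) (T.subtree v) s v)
    (hsp : Stores n (T.gain W) U s p) (hU : Disjoint (T.subtree v) U) (hWU : W ⊆ U)
    (hW : ∀ u ∈ W, T.subtree u ⊆ U) (hvv : ∀ u ∈ T.subtree v, T.subtree u ⊆ T.subtree v)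
    (hvm : v ∈ T.subtree v) :
    Within absorb s (absorbCost * n) fun s' =>
      Frame n (reps s v) s s' ∧ s'.natReg 10 = p ∧ s.natReg 4 ≤ s'.natReg 6 ∧
      s'.natReg 6 ≤ s'.natReg 11 ∧
      (∀ c ∈ seg (s'.natArr 5) (s'.natReg 6) (s'.natReg 11),
        s'.natArr 6 c = c ∧ ∃ u ∈ T.subtree v ∪ U, (u : ℕ) = c) ∧
      (seg (s'.natArr 5) (s'.natReg 6) (s'.natReg 11)).Nodup ∧
      ((seg (s'.natArr 5) (s'.natReg 6) (s'.natReg 11)).Pairwise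
        fun a b => s'.realArr 1 b ≤ s'.realArr 1 a) ∧
      Represents (T.gain (T.subtree v ∪ W)) (T.subtree v ∪ U)
        ((seg (s'.natArr 5) (s'.natReg 6) (s'.natReg 11)).map (block n s')) := by
  refine (Within.seq ((iron_within hv hsv.lo_le hsv.hi_le hsv.lt hsv.fixed hsv.nodup
    hsv.represents).mono le_rfl ?_)).mono (t := (ironBody.flatCost * (2 * n + 1) + 20 * n + 20) +
      ((chargeBody.flatCost * n + 20 * n + 20) + (mergeBody.flatCost * n + 50 * n + 50))) ?_
      fun _ h => h
  swap
  -- Constants are absorbed by `n ≥ 1`: `2 n + 1 ≤ 3 n` and `90 n + 90 ≤ 180 n`.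
  · have : 1 ≤ n := by have := v.2; omega
    simp only [absorbCost]
    nlinarith
  rintro s₁ ⟨f₁, hle₁, hnd₁, hmem₁, hrep₁, hiron₁⟩
  have r4 : s₁.natReg 4 = s.natReg 4 := f₁.natReg 4 (by norm_num)
  have r3 : s₁.natReg 3 = v := (f₁.natReg 3 (by norm_num)).trans hv
  have a0 : s₁.realArr 0 = s.realArr 0 := f₁.realArr 0 (by norm_num) (by norm_num)
  rw [← r4] at hle₁ hnd₁ hmem₁ hrep₁ hiron₁
  refine Within.seq ((charge_within (n := n) hnd₁ (fun c hc => hsv.lt c (hmem₁ c hc).1)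
    hle₁).mono le_rfl ?_)
  rintro s₂ ⟨f₂, hA₂, h6, h47, h76, hshift⟩
  have f₁₂ : Frame n (reps s v) s s₂ := f₁.trans f₂ fun c hc => (hmem₁ c hc).1
  have r4' : s₂.natReg 4 = s.natReg 4 := f₁₂.natReg 4 (by norm_num)
  have r3' : s₂.natReg 3 = v := (f₁₂.natReg 3 (by norm_num)).trans hv
  have hsp₂ : Stores n (T.gain W) U s₂ p := hsp.frame f₁₂ (hsv.notMem hsp hU)
  have hrp : reps s₂ p = reps s p := f₁₂.reps_eq hsp.hi_le
  rw [r3, a0, hlen] at hshift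
  rw [← h6, ← hA₂] at hshift
  have hrepA : Represents (T.gain (T.subtree v)) (T.subtree v)
      ((seg (s₂.natArr 5) (s₂.natReg 7) (s₂.natReg 6)).map (block n s₂)) := by
    have h1 := (hrep₁.shift hiron₁ h0).insert_edge (Finset.notMem_erase v _)
    rw [Finset.insert_erase hvm] at h1
    rw [hshift, hA₂, h6]
    exact h1
  have hsortA : (seg (s₂.natArr 5) (s₂.natReg 7) (s₂.natReg 6)).Pairwise
      fun a b => s₂.realArr 1 b ≤ s₂.realArr 1 a := by
    have h1 := Block.shift_pairwise hiron₁ hrep₁.valid (T.len v)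
    rw [h6, hA₂] at hshift ⊢
    rw [← hshift, List.pairwise_map] at h1
    exact h1
  have hsub : ∀ c ∈ seg (s₂.natArr 5) (s₂.natReg 7) (s₂.natReg 6),
      c ∈ reps s v ∧ s₂.natArr 6 c = c := by
    intro c hc
    rw [hA₂, h6] at *
    apply hmem₁
    obtain ⟨i, h1, h2, h3⟩ := mem_seg.1 hc
    exact mem_seg.2 ⟨i, by omega, h2, h3⟩
  have hndA : (seg (s₂.natArr 5) (s₂.natReg 7) (s₂.natReg 6) ++ reps s₂ p).Nodup := by
    refine List.nodup_append'.2 ⟨?_, hsp₂.nodup, ?_⟩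
    · rw [hA₂, h6]
      rw [seg_append h47 h76] at hnd₁
      exact hnd₁.of_append_left
    · intro c hc hc'
      rw [hrp] at hc'
      exact hsv.notMem hsp hU c hc' (hsub c hc).1
  refine (merge_within (n := n) (p := p) ?_ (by omega) (by omega) hsp₂.lo_le hsp₂.hi_le hsortA
    hsp₂.sorted hndA ?_).mono le_rfl ?_
  · rw [r3', f₁₂.natArr 0 (by norm_num) (by norm_num), hp]
  · intro c hc
    rcases List.mem_append.1 hc with hc | hc
    · exact hsv.lt c (hsub c hc).1
    · exact hsp₂.lt c hc
  · rintro s₃ ⟨f₃, hb₃, hp₃, h10, h6', h11, hperm, hM⟩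
    rw [h6']
    refine ⟨f₁₂.trans f₃ (by simp), h10, by omega, h11, fun c hc => ?_, hperm.nodup_iff.2 hndA,
      ?_, ?_⟩
    · rw [hp₃]
      rcases List.mem_append.1 (hperm.mem_iff.1 hc) with hc | hc
      · obtain ⟨h1, h2⟩ := hsub c hc
        obtain ⟨u, hu, h3⟩ := hsv.mem c h1
        exact ⟨h2, u, Finset.mem_union_left _ hu, h3⟩
      · obtain ⟨u, hu, h3⟩ := hsp₂.mem c hc
        exact ⟨hsp₂.fixed c hc, u, Finset.mem_union_right _ hu, h3⟩
    · have h1 := hM.pairwise (List.pairwise_map.2 hsortA) (List.pairwise_map.2 hsp₂.sorted)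
      rw [← hb₃, List.pairwise_map] at h1
      exact h1
    · rw [hb₃]
      exact hrepA.merge hsp₂.represents hM hU
        (Finset.disjoint_of_subset_right hWU hU) hvv hW

/-- Register the merged list as the list of the parent, and the current node as processed. -/
def close : Prog :=
  .seq (.putNat 3 (.reg 10) (.reg 6)) (.seq (.putNat 4 (.reg 10) (.reg 11))
    (.seq (.setNat 4 (.reg 11)) (.seq (.putNat 2 (.reg 3) (.const 1))
      (.seq (.putNat 2 (.reg 10) (.sub (.get 2 (.reg 10)) (.const 1)))
        (.setNat 2 (.add (.reg 2) (.const 1)))))))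

/-- Process one node. -/
def round : Prog := .seq findLeaf (.seq absorb close)

open scoped Classical in
/-- The state of the computation when the nodes of `D` have been processed; `U v` is the union of
`{v}` and the sub-trees of the processed children of `v`. -/
structure Progress {n : ℕ} (T : PPTPT n) (D : Finset (Fin n)) (U : Fin n → Finset (Fin n))
    (s : State) : Prop where
  nodes_eq : s.natReg 0 = n
  root_eq : s.natReg 1 = T.root
  round_eq : s.natReg 2 = D.card + 1
  parent_eq : ∀ v : Fin n, s.natArr 0 v = T.parent v
  len_eq : ∀ v : Fin n, s.realArr 0 v = T.len v
  unmarked : ∀ i, s.natArr 7 i = 0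
  ptr_lt : ∀ u < n, s.natArr 6 u < n
  root_notMem : T.root ∉ D
  closed : ∀ v, T.parent v ∈ D → v ∈ D
  pending : ∀ v ∉ D, s.natArr 2 v = (Finset.univ.filter fun c => T.parent c = v ∧ c ∉ D).card
  done : ∀ v : Fin n, v ∈ D → s.natArr 2 v ≠ 0
  self_mem : ∀ v ∉ D, v ∈ U v
  below : ∀ v ∉ D, U v ⊆ T.subtree v
  subtree_subset : ∀ v ∉ D, ∀ u ∈ U v, u ≠ v → T.subtree u ⊆ U v
  child_mem : ∀ v ∉ D, ∀ c ∈ D, T.parent c = v → c ∈ U v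
  disjoint : ∀ v ∉ D, ∀ w ∉ D, v ≠ w → Disjoint (U v) (U w)
  stores : ∀ v ∉ D, Stores n (T.gain ((U v).erase v)) (U v) s v

end RealRAM

/-! ### Combinatorics of rooted sub-trees -/

namespace PPTPT

variable {n : ℕ}

theorem self_mem_subtree (T : PPTPT n) (v : Fin n) : v ∈ T.subtree v := T.mem_subtree.2 ⟨0, rfl⟩

theorem subtree_subset_subtree (T : PPTPT n) {u v : Fin n} (h : u ∈ T.subtree v) :
    T.subtree u ⊆ T.subtree v := by
  intro w hw
  obtain ⟨k, rfl⟩ := T.mem_subtree.1 h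
  obtain ⟨l, rfl⟩ := T.mem_subtree.1 hw
  exact T.mem_subtree.2 ⟨k + l, Function.iterate_add_apply _ _ _ _⟩

theorem subtree_parent (T : PPTPT n) (v : Fin n) : T.subtree v ⊆ T.subtree (T.parent v) :=
  T.subtree_subset_subtree (T.mem_subtree.2 ⟨1, rfl⟩)

/-- A proper descendant of `v` is a descendant of a child of `v`. -/
theorem exists_child (T : PPTPT n) {u v : Fin n} (h : u ∈ T.subtree v) (huv : u ≠ v) :
    ∃ c, T.parent c = v ∧ c ≠ v ∧ u ∈ T.subtree c := by
  obtain ⟨k, hk⟩ := T.mem_subtree.1 h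
  induction k generalizing u with
  | zero => exact absurd hk huv
  | succ k ih =>
    rw [Function.iterate_succ_apply] at hk
    by_cases hp : T.parent u = v
    · exact ⟨u, hp, huv, T.self_mem_subtree u⟩
    · obtain ⟨c, h1, h2, h3⟩ := ih (T.mem_subtree.2 ⟨k, hk⟩) hp hk
      exact ⟨c, h1, h2, T.subtree_subset_subtree h3 (T.mem_subtree.2 ⟨1, rfl⟩)⟩

/-- Outside a set that does not contain the root and another node, some node has no child. -/
theorem exists_leaf (T : PPTPT n) {D : Finset (Fin n)} (hD : D.card + 1 < n) (hr : T.root ∉ D) :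
    ∃ v ∉ D, ∀ c, T.parent c = v → c ∈ D := by
  classical
  let depth : Fin n → ℕ := fun v => Nat.find (T.reaches_root v)
  have hne : ((insert T.root D)ᶜ : Finset (Fin n)).Nonempty := by
    rw [← Finset.card_pos, Finset.card_compl, Finset.card_insert_of_notMem hr, Fintype.card_fin]
    omega
  -- A deepest node other than the root outside `D`: a child outside `D` would be deeper still.
  obtain ⟨v, hv, hmax⟩ := Finset.exists_max_image _ depth hne
  simp only [Finset.mem_compl, Finset.mem_insert, not_or] at hv hmax
  refine ⟨v, hv.2, fun c hc => ?_⟩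
  by_contra hcD
  have hcr : c ≠ T.root := by
    rintro rfl
    exact hv.1 (hc.symm.trans T.parent_root)
  have h1 := hmax c ⟨hcr, hcD⟩
  have h2 : T.parent^[depth c] c = T.root := Nat.find_spec (T.reaches_root c)
  have h3 : depth c ≠ 0 := by
    intro h0
    rw [h0] at h2
    exact hcr h2
  obtain ⟨k, hk⟩ := Nat.exists_eq_succ_of_ne_zero h3
  rw [hk, Nat.succ_eq_add_one, Function.iterate_succ_apply, hc] at h2
  have h4 : depth v ≤ k := Nat.find_min' _ h2
  omega

end PPTPT

/-! ### One round and the invariant between rounds -/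

namespace RealRAM

open PPTPT

/-- When all children of `v` have been processed, `U v` is the sub-tree of `v`. -/
theorem Progress.eq_subtree {n : ℕ} {T : PPTPT n} {D : Finset (Fin n)} {U : Fin n → Finset (Fin n)}
    {s : State} (h : Progress T D U s) {v : Fin n} (hv : v ∉ D)
    (hc : ∀ c, T.parent c = v → c ≠ v → c ∈ D) : U v = T.subtree v := by
  refine Finset.Subset.antisymm (h.below v hv) fun u hu => ?_
  by_cases huv : u = v
  · rw [huv]
    exact h.self_mem v hv
  · obtain ⟨c, h1, h2, h3⟩ := T.exists_child hu huv
    exact h.subtree_subset v hv c (h.child_mem v hv c (hc c h1 h2) h1) h2 h3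

/-- A bound for the number of steps of a round, per node of the tree. -/
def roundCost : ℕ := absorbCost + close.flatCost + 18

/-- A zero counter identifies an unprocessed node with no pending child. The root is never chosen,
since it counts as its own pending child, and a processed node is not chosen again, since its
counter is set to `1`. -/
theorem round_within {n : ℕ} {T : PPTPT n} {D : Finset (Fin n)} {U : Fin n → Finset (Fin n)}
    {s : State} (h : Progress T D U s) (hD : D.card + 1 < n) :
    Within round s (roundCost * n) fun s' =>
      ∃ D' U', D'.card = D.card + 1 ∧ Progress T D' U' s' := by
  classical
  have hleaf : ∃ v < n, s.natArr 2 v = 0 := by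
    obtain ⟨v, hv, hc⟩ := T.exists_leaf hD h.root_notMem
    refine ⟨v, v.2, ?_⟩
    rw [h.pending v hv, Finset.card_eq_zero, Finset.filter_eq_empty_iff]
    exact fun c _ hc' => hc'.2 (hc c hc'.1)
  refine (Within.seq (t' := absorbCost * n + close.flatCost)
    ((findLeaf_within hleaf).mono le_rfl ?_)).mono ?_ fun _ h => h
  swap
  · simp only [roundCost]
    nlinarith
  rintro _ ⟨v', hv', hv0, rfl⟩
  obtain ⟨v, rfl⟩ : ∃ v : Fin n, (v : ℕ) = v' := ⟨⟨v', hv'⟩, rfl⟩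
  have hvD : v ∉ D := fun hc => h.done v hc hv0
  have hch : ∀ c, T.parent c = v → c ∈ D := by
    have := hv0
    rw [h.pending v hvD, Finset.card_eq_zero, Finset.filter_eq_empty_iff] at this
    intro c hc
    by_contra hcD
    exact this (Finset.mem_univ c) ⟨hc, hcD⟩
  set p := T.parent v with hp
  -- A node that points to itself would be its own pending child; in particular `v` is not the root.
  have hpv : p ≠ v := fun hc => hvD (hch v hc)
  have hpD : p ∉ D := fun hc => hvD (h.closed v hc)
  have hvr : v ≠ T.root := by
    rintro rfl
    exact hpv T.parent_root
  have hUv := h.eq_subtree hvD fun c hc _ => hch c hc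
  set s₁ := s.setNat 3 v with hs₁
  have hst : ∀ w ∉ D, Stores n (T.gain ((U w).erase w)) (U w) s₁ w := fun w hw => by
    obtain ⟨h1, h2, h3, h4, h5, h6, h7⟩ := h.stores w hw
    exact ⟨h1, h2, h3, h4, h5, h6, h7⟩
  have hsv := hst v hvD
  rw [hUv] at hsv
  have hdj := h.disjoint v hvD p hpD hpv.symm
  have hdj' := hdj
  rw [hUv] at hdj
  refine Within.seq ((absorb_within T (s := s₁) (v := v) (p := p) (by simp [hs₁])
    (h.parent_eq v) (h.len_eq v) (T.len_nonneg v hvr) hsv (hst p hpD) hdj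
    (Finset.erase_subset _ _) ?_ (fun u hu => T.subtree_subset_subtree hu)
    (T.self_mem_subtree v)).mono le_rfl ?_)
  · intro u hu
    rw [Finset.mem_erase] at hu
    exact h.subtree_subset p hpD u hu.2 hu.1
  rintro s₂ ⟨hf, h10, h46, h611, hmem, hnd, hsort, hrep⟩
  refine Within.flat (by simp [close, Prog.Flat]) ?_
  set s₃ := close.flat s₂ with hs₃
  have r3 : s₂.natReg 3 = v := by rw [hf.natReg 3 (by norm_num)]; simp [hs₁]
  have rr : ∀ r < 5, r ≠ 3 → s₂.natReg r = s.natReg r := fun r hr hr' => by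
    rw [hf.natReg r hr]
    simp [hs₁, hr']
  have hpv' : (p : ℕ) ≠ v := fun hc => hpv (Fin.ext hc)
  have e4 : s₃.natReg 4 = s₂.natReg 11 := by simp [hs₃, close, Prog.flat, NatExpr.eval]
  have a3 : s₃.natArr 3 = Function.update (s₂.natArr 3) p (s₂.natReg 6) := by
    simp [hs₃, close, Prog.flat, NatExpr.eval, h10]
  have a4 : s₃.natArr 4 = Function.update (s₂.natArr 4) p (s₂.natReg 11) := by
    simp [hs₃, close, Prog.flat, NatExpr.eval, h10]
  have a2 : s₃.natArr 2 = Function.update (Function.update (s₂.natArr 2) v 1) p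
      (s₂.natArr 2 p - 1) := by
    simp [hs₃, close, Prog.flat, NatExpr.eval, h10, r3, hpv']
  have aA : ∀ a, a ≠ 2 → a ≠ 3 → a ≠ 4 → s₃.natArr a = s₂.natArr a := by
    intro a h2 h3 h4
    simp [hs₃, close, Prog.flat, NatExpr.eval, h2, h3, h4]
  have aR : s₃.realArr = s₂.realArr := by simp [hs₃, close, Prog.flat]
  have hblk : block n s₃ = block n s₂ := by
    funext c
    simp [block, aR, aA 6 (by norm_num) (by norm_num) (by norm_num)]
  have hA : ∀ a, a ≠ 2 → a ≠ 3 → a ≠ 4 → a ≠ 5 → a ≠ 6 → s₃.natArr a = s.natArr a := by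
    intro a h2 h3 h4 h5 h6
    rw [aA a h2 h3 h4, hf.natArr a h5 h6]
    rfl
  have hA2 : s₂.natArr 2 = s.natArr 2 := hf.natArr 2 (by norm_num) (by norm_num)
  -- The value of the new family at `v` is immaterial: the invariant concerns only the sets of
  -- unprocessed nodes.
  refine ⟨insert v D, Function.update U p (U v ∪ U p), Finset.card_insert_of_notMem hvD, ?_⟩
  have hD' : ∀ {w}, w ∉ insert v D → w ≠ v ∧ w ∉ D := fun {w} hw => by
    simpa [Finset.mem_insert, not_or] using hw
  constructor
  · simp [hs₃, close, Prog.flat, rr, h.nodes_eq]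
  · simp [hs₃, close, Prog.flat, rr, h.root_eq]
  · simp [hs₃, close, Prog.flat, NatExpr.eval, rr, h.round_eq, Finset.card_insert_of_notMem hvD]
  · intro w
    rw [hA 0 (by norm_num) (by norm_num) (by norm_num) (by norm_num) (by norm_num), h.parent_eq]
  · intro w
    rw [aR, hf.realArr 0 (by norm_num) (by norm_num)]
    exact h.len_eq w
  · intro i
    rw [hA 7 (by norm_num) (by norm_num) (by norm_num) (by norm_num) (by norm_num), h.unmarked]
  · rw [aA 6 (by norm_num) (by norm_num) (by norm_num)]
    exact hf.ptr_lt h.ptr_lt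
  · simp [hvr.symm, h.root_notMem]
  · intro w hw
    rcases Finset.mem_insert.1 hw with hw | hw
    · exact Finset.mem_insert_of_mem (hch w hw)
    · exact Finset.mem_insert_of_mem (h.closed w hw)
  · intro w hw
    obtain ⟨hwv, hwD⟩ := hD' hw
    have hwv' : (w : ℕ) ≠ v := fun hc => hwv (Fin.ext hc)
    rw [a2]
    by_cases hwp : w = p
    · subst hwp
      rw [Function.update_self, hA2, h.pending _ hwD]
      have : (Finset.univ.filter fun c => T.parent c = p ∧ c ∉ insert v D) =
          (Finset.univ.filter fun c => T.parent c = p ∧ c ∉ D).erase v := by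
        ext c
        simp only [Finset.mem_filter, Finset.mem_univ, true_and, Finset.mem_erase,
          Finset.mem_insert, not_or]
        tauto
      rw [this, Finset.card_erase_of_mem (by simp [hvD, ← hp])]
    · have hwp' : (w : ℕ) ≠ p := fun hc => hwp (Fin.ext hc)
      rw [Function.update_of_ne hwp', Function.update_of_ne hwv', hA2, h.pending _ hwD]
      congr 1
      ext c
      simp only [Finset.mem_filter, Finset.mem_univ, true_and, Finset.mem_insert, not_or]
      refine ⟨fun hc => ⟨hc.1, fun hcv => ?_, hc.2⟩, fun hc => ⟨hc.1, hc.2.2⟩⟩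
      rw [hcv] at hc
      exact hwp hc.1.symm
  · intro w hw
    have hwp : (w : ℕ) ≠ p := by
      intro hc
      rw [Fin.ext hc] at hw
      rcases Finset.mem_insert.1 hw with hw | hw
      · exact hpv hw
      · exact hpD hw
    rw [a2, Function.update_of_ne hwp]
    by_cases hwv : w = v
    · rw [hwv]
      simp
    · have hwv' : (w : ℕ) ≠ v := fun hc => hwv (Fin.ext hc)
      rw [Function.update_of_ne hwv', hA2]
      exact h.done w ((Finset.mem_insert.1 hw).resolve_left hwv)
  · intro w hw
    obtain ⟨hwv, hwD⟩ := hD' hw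
    by_cases hwp : w = p
    · subst hwp
      rw [Function.update_self]
      exact Finset.mem_union_right _ (h.self_mem _ hwD)
    · rw [Function.update_of_ne hwp]
      exact h.self_mem w hwD
  · intro w hw
    obtain ⟨hwv, hwD⟩ := hD' hw
    by_cases hwp : w = p
    · subst hwp
      rw [Function.update_self, hUv]
      exact Finset.union_subset (T.subtree_parent v) (h.below _ hwD)
    · rw [Function.update_of_ne hwp]
      exact h.below w hwD
  · intro w hw u hu huw
    obtain ⟨hwv, hwD⟩ := hD' hw
    by_cases hwp : w = p
    · subst hwp
      rw [Function.update_self] at hu ⊢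
      rcases Finset.mem_union.1 hu with hu | hu
      · refine Finset.Subset.trans ?_ Finset.subset_union_left
        rw [hUv] at hu ⊢
        exact T.subtree_subset_subtree hu
      · exact (h.subtree_subset _ hwD u hu huw).trans Finset.subset_union_right
    · rw [Function.update_of_ne hwp] at hu ⊢
      exact h.subtree_subset w hwD u hu huw
  · intro w hw c hc hcw
    obtain ⟨hwv, hwD⟩ := hD' hw
    rcases Finset.mem_insert.1 hc with hc | hc
    · have hwp : w = p := by rw [← hcw, hc]
      rw [hwp, Function.update_self, hc]
      exact Finset.mem_union_left _ (h.self_mem v hvD)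
    · by_cases hwp : w = p
      · rw [hwp, Function.update_self]
        exact Finset.mem_union_right _ (h.child_mem p hpD c hc (hcw.trans hwp))
      · rw [Function.update_of_ne hwp]
        exact h.child_mem w hwD c hc hcw
  · intro w hw x hx hwx
    obtain ⟨hwv, hwD⟩ := hD' hw
    obtain ⟨hxv, hxD⟩ := hD' hx
    by_cases hwp : w = p
    · have hxp : x ≠ p := fun hc => hwx (hwp.trans hc.symm)
      rw [hwp, Function.update_self, Function.update_of_ne hxp]
      exact Finset.disjoint_union_left.2 ⟨h.disjoint v hvD x hxD hxv.symm,
        h.disjoint p hpD x hxD hxp.symm⟩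
    · rw [Function.update_of_ne hwp]
      by_cases hxp : x = p
      · rw [hxp, Function.update_self]
        exact Finset.disjoint_union_right.2 ⟨h.disjoint w hwD v hvD hwv,
          h.disjoint w hwD p hpD hwp⟩
      · rw [Function.update_of_ne hxp]
        exact h.disjoint w hwD x hxD hwx
  · intro w hw
    obtain ⟨hwv, hwD⟩ := hD' hw
    have a5 : s₃.natArr 5 = s₂.natArr 5 := aA 5 (by norm_num) (by norm_num) (by norm_num)
    have a6 : s₃.natArr 6 = s₂.natArr 6 := aA 6 (by norm_num) (by norm_num) (by norm_num)
    by_cases hwp : w = p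
    · rw [hwp, Function.update_self]
      have hreps : reps s₃ p = seg (s₂.natArr 5) (s₂.natReg 6) (s₂.natReg 11) := by
        rw [reps, a3, a4, a5, Function.update_self, Function.update_self]
      refine ⟨?_, ?_, ?_, ?_, ?_, ?_, ?_⟩
      · rw [a3, a4, Function.update_self, Function.update_self]
        exact h611
      · rw [a4, e4, Function.update_self]
      all_goals rw [hreps]
      · rw [a6]
        exact fun c hc => (hmem c hc).1
      · rw [hUv]
        exact fun c hc => (hmem c hc).2
      · exact hnd
      · rw [aR]
        exact hsort
      -- The edge above `v` is accounted for now, the edge above `p` not yet.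
      · have : (U v ∪ U p).erase p = T.subtree v ∪ (U p).erase p := by
          rw [Finset.erase_union_distrib, hUv, Finset.erase_eq_of_notMem]
          exact Finset.disjoint_right.1 hdj (h.self_mem p hpD)
        rw [hblk, this, hUv]
        exact hrep
    · have hwp' : (w : ℕ) ≠ p := fun hc => hwp (Fin.ext hc)
      rw [Function.update_of_ne hwp]
      have hw₂ := (hst w hwD).frame hf ((hst v hvD).notMem (hst w hwD)
        (h.disjoint v hvD w hwD hwv.symm))
      have h3w : s₃.natArr 3 w = s₂.natArr 3 w := by rw [a3, Function.update_of_ne hwp']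
      have h4w : s₃.natArr 4 w = s₂.natArr 4 w := by rw [a4, Function.update_of_ne hwp']
      have hreps : reps s₃ w = reps s₂ w := by rw [reps, reps, a5, h3w, h4w]
      have h4' : s₂.natReg 4 = s.natReg 4 := rr 4 (by norm_num) (by norm_num)
      have h46' : s.natReg 4 ≤ s₂.natReg 6 := h46
      have := hw₂.hi_le
      refine ⟨by rw [h3w, h4w]; exact hw₂.lo_le, by rw [h4w, e4]; omega, ?_, ?_, ?_, ?_, ?_⟩
      all_goals rw [hreps]
      · rw [a6]; exact hw₂.fixed
      · exact hw₂.mem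
      · exact hw₂.nodup
      · rw [aR]; exact hw₂.sorted
      · rw [hblk]; exact hw₂.represents

end RealRAM

/-! ### Initialization, output and the total time -/

namespace RealRAM

open PPTPT

/-- Create the list of blocks of node `i`, and announce it to its parent. -/
def initBody : Prog :=
  .seq (.putReal 2 (.reg 5) (.sub (.const 1) (.get 2 (.reg 5))))
    (.seq (.putNat 6 (.reg 5) (.reg 5)) (.seq (.putNat 5 (.reg 5) (.reg 5))
    (.seq (.putNat 3 (.reg 5) (.reg 5))
    (.seq (.putNat 2 (.get 0 (.reg 5)) (.add (.get 2 (.get 0 (.reg 5))) (.const 1)))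
    (.seq (.ite (.realLt (.get 1 (.reg 5)) (.const 0)) (.putNat 4 (.reg 5) (.reg 5))
      (.putNat 4 (.reg 5) (.add (.reg 5) (.const 1))))
    (.setNat 5 (.add (.reg 5) (.const 1))))))))

/-- Create the lists of blocks of all nodes. -/
def init : Prog :=
  .seq (.loop (.natLt (.reg 5) (.reg 0)) initBody)
    (.seq (.setNat 4 (.reg 0)) (.setNat 2 (.const 1)))

open scoped Classical in
/-- The lists of the first `natReg 5` nodes have been created. -/
structure InitInv {n : ℕ} (T : PPTPT n) (m : ℕ) (s : State) : Prop where
  index_le : s.natReg 5 ≤ n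
  measure : m = n - s.natReg 5
  natReg : ∀ r, r ≠ 5 → s.natReg r = T.input.natReg r
  parents : s.natArr 0 = T.input.natArr 0
  marks : s.natArr 7 = T.input.natArr 7
  realArr : ∀ a, a ≠ 2 → s.realArr a = T.input.realArr a
  idle : ∀ j < s.natReg 5, s.realArr 2 j = 1 - T.input.realArr 2 j
  prob : ∀ j, s.natReg 5 ≤ j → s.realArr 2 j = T.input.realArr 2 j
  ptr : ∀ j < s.natReg 5, s.natArr 6 j = j
  mem : ∀ j < s.natReg 5, s.natArr 5 j = j
  low : ∀ j < s.natReg 5, s.natArr 3 j = j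
  high : ∀ j < s.natReg 5, s.natArr 4 j = if T.input.realArr 1 j < 0 then j else j + 1
  pending : ∀ w : Fin n, s.natArr 2 w =
    (Finset.univ.filter fun c : Fin n => (c : ℕ) < s.natReg 5 ∧ T.parent c = w).card

theorem input_parent {n : ℕ} (T : PPTPT n) (v : Fin n) : T.input.natArr 0 v = T.parent v := by
  simp [input, toArray]

/-- Real array `2` is turned in place from request into idle probabilities, hence separate clauses
on the two sides of the index. The self-pointer of the root is counted like any other child. -/
theorem initInv_step {n : ℕ} {T : PPTPT n} {m : ℕ} {s : State} (h : InitInv T m s)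
    (hb : (Test.natLt (.reg 5) (.reg 0)).Holds s) :
    ∃ m' < m, InitInv T m' (initBody.flat s) := by
  classical
  obtain ⟨hle, rfl, hreg, hpar, hmark, hreal, hidle, hprob, hptr, hmem, hlow, hhigh, hpend⟩ := h
  have hn : T.input.natReg 0 = n := rfl
  have hi : s.natReg 5 < n := by
    simpa [Test.Holds, NatExpr.eval, hreg 0 (by norm_num), hn] using hb
  set i := s.natReg 5 with hi_def
  have hp0 : s.natArr 0 i = T.parent ⟨i, hi⟩ := by
    rw [hpar]
    exact input_parent T ⟨i, hi⟩
  have hK : s.realArr 1 = T.input.realArr 1 := hreal 1 (by norm_num)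
  set s' := initBody.flat s with hs'
  have hflat : s' = (((((((s.putReal 2 i (1 - s.realArr 2 i)).putNat 6 i i).putNat 5 i i).putNat
      3 i i).putNat 2 (s.natArr 0 i) (s.natArr 2 (s.natArr 0 i) + 1)).putNat 4 i
      (if T.input.realArr 1 i < 0 then i else i + 1)).setNat 5 (i + 1)) := by
    rw [← hK]
    by_cases hneg : s.realArr 1 i < 0 <;>
      simp [hs', initBody, Prog.flat, Test.Holds, NatExpr.eval, RealExpr.eval, hneg, ← hi_def]
  rw [hp0] at hflat
  have e5 : s'.natReg = Function.update s.natReg 5 (i + 1) := by simp [hflat]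
  have eR : s'.realArr = Function.update s.realArr 2
      (Function.update (s.realArr 2) i (1 - s.realArr 2 i)) := by simp [hflat]
  have eA : ∀ a, a ≠ 6 → a ≠ 5 → a ≠ 4 → a ≠ 3 → a ≠ 2 → s'.natArr a = s.natArr a := by
    intro a h1 h2 h3 h4 h5
    simp [hflat, h1, h2, h3, h4, h5]
  have e6 : s'.natArr 6 = Function.update (s.natArr 6) i i := by simp [hflat]
  have eM : s'.natArr 5 = Function.update (s.natArr 5) i i := by simp [hflat]
  have e3 : s'.natArr 3 = Function.update (s.natArr 3) i i := by simp [hflat]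
  have e4 : s'.natArr 4 = Function.update (s.natArr 4) i
      (if T.input.realArr 1 i < 0 then i else i + 1) := by simp [hflat]
  have e2 : s'.natArr 2 = Function.update (s.natArr 2) (T.parent ⟨i, hi⟩)
      (s.natArr 2 (T.parent ⟨i, hi⟩) + 1) := by simp [hflat]
  have ei : s'.natReg 5 = i + 1 := by rw [e5, Function.update_self]
  have upd : ∀ {α : Type} {f : ℕ → α} {g : ℕ → α} {x : α}, x = g i → (∀ j < i, f j = g j) →
      ∀ j < s'.natReg 5, Function.update f i x j = g j := by
    intro α f g x hx hf j hj
    rw [ei] at hj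
    rcases Nat.lt_succ_iff_lt_or_eq.1 hj with hj | rfl
    · rw [Function.update_of_ne hj.ne, hf j hj]
    · rw [Function.update_self, hx]
  refine ⟨n - (i + 1), by omega, by omega, by omega, fun r hr => ?_, ?_, ?_, fun a ha => ?_,
    ?_, fun j hj => ?_, ?_, ?_, ?_, ?_, fun w => ?_⟩
  · rw [e5, Function.update_of_ne hr, hreg r hr]
  · rw [eA 0 (by norm_num) (by norm_num) (by norm_num) (by norm_num) (by norm_num), hpar]
  · rw [eA 7 (by norm_num) (by norm_num) (by norm_num) (by norm_num) (by norm_num), hmark]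
  · rw [eR, Function.update_of_ne ha, hreal a ha]
  · rw [eR, Function.update_self]
    exact upd (g := fun j => 1 - T.input.realArr 2 j) (by rw [hprob i le_rfl]) hidle
  · rw [eR, Function.update_self, Function.update_of_ne (by omega)]
    exact hprob j (by omega)
  · rw [e6]; exact upd (g := fun j => j) rfl hptr
  · rw [eM]; exact upd (g := fun j => j) rfl hmem
  · rw [e3]; exact upd (g := fun j => j) rfl hlow
  · rw [e4]; exact upd (g := fun j => if T.input.realArr 1 j < 0 then j else j + 1) rfl hhigh
  · rw [e2, ei]
    by_cases hw : w = T.parent ⟨i, hi⟩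
    · rw [hw, Function.update_self, hpend]
      have : (Finset.univ.filter fun c : Fin n => (c : ℕ) < i + 1 ∧
          T.parent c = T.parent ⟨i, hi⟩) = insert ⟨i, hi⟩
          (Finset.univ.filter fun c : Fin n => (c : ℕ) < i ∧ T.parent c = T.parent ⟨i, hi⟩) := by
        ext c
        simp only [Finset.mem_filter, Finset.mem_univ, true_and, Finset.mem_insert, Fin.ext_iff]
        constructor
        · rintro ⟨h1, h2⟩
          rcases Nat.lt_succ_iff_lt_or_eq.1 h1 with h1 | h1
          · exact Or.inr ⟨h1, h2⟩
          · exact Or.inl h1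
        · rintro (h1 | ⟨h1, h2⟩)
          · exact ⟨by omega, by congr 2; exact Fin.ext h1⟩
          · exact ⟨by omega, h2⟩
      rw [this, Finset.card_insert_of_notMem (by simp)]
    · have hw' : (w : ℕ) ≠ T.parent ⟨i, hi⟩ := fun hc => hw (Fin.ext hc)
      rw [Function.update_of_ne hw', hpend]
      congr 1
      ext c
      simp only [Finset.mem_filter, Finset.mem_univ, true_and]
      refine ⟨fun hc => ⟨by omega, hc.2⟩, fun hc => ⟨?_, hc.2⟩⟩
      rcases Nat.lt_succ_iff_lt_or_eq.1 hc.1 with h1 | h1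
      · exact h1
      · have : c = ⟨i, hi⟩ := Fin.ext h1
        rw [this] at hc
        exact absurd hc.2.symm hw

/-- Initially each node stands alone with no edge charged. The list of `v` uses at most the cell
`v`, so cell `n` is the first free one. -/
theorem init_within {n : ℕ} (T : PPTPT n) :
    Within init T.input ((initBody.flatCost + 5) * n + 10) fun s =>
      Progress T ∅ (fun v => {v}) s := by
  classical
  refine (Within.seq ((Within.flat_loop (by simp [initBody, Prog.Flat]) (InitInv T)
    (fun m s h hb => initInv_step h hb) (m := n) (s := T.input) ?_).mono le_rfl ?_)).mono
    (t := n * (4 + initBody.flatCost) + 4 + 4) ?_ fun _ h => h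
  · have h5 : T.input.natReg 5 = 0 := rfl
    refine ⟨by omega, by omega, fun _ _ => rfl, rfl, rfl, fun _ _ => rfl, ?_, fun _ _ => rfl,
      ?_, ?_, ?_, ?_, fun w => ?_⟩
    all_goals simp only [h5, not_lt_zero, IsEmpty.forall_iff, implies_true, false_and,
      Finset.filter_false, Finset.card_empty]
    rfl
  swap
  · nlinarith
  rintro s₁ ⟨⟨m, h⟩, hb⟩
  have hn : T.input.natReg 0 = n := rfl
  have hi : s₁.natReg 5 = n := by
    refine le_antisymm h.index_le ?_
    simpa [Test.Holds, NatExpr.eval, h.natReg 0 (by norm_num), hn] using hb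
  obtain ⟨-, -, hreg, hpar, hmark, hreal, hidle, -, hptr, hmem, hlow, hhigh, hpend⟩ := h
  rw [hi] at hidle hptr hmem hlow hhigh hpend
  refine Within.flat (by simp [Prog.Flat]) ?_
  set s := (Prog.seq (.setNat 4 (.reg 0)) (.setNat 2 (.const 1))).flat s₁ with hs
  have eA : s.natArr = s₁.natArr := rfl
  have eR : s.realArr = s₁.realArr := rfl
  have e4 : s.natReg 4 = n := by simp [hs, Prog.flat, NatExpr.eval, hreg, hn]
  have hlen : ∀ v : Fin n, T.input.realArr 0 v = T.len v := fun v => by simp [input, toArray]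
  have hprize : ∀ v : Fin n, T.input.realArr 1 v = T.prize v := fun v => by simp [input, toArray]
  have hpr : ∀ v : Fin n, T.input.realArr 2 v = T.prob v := fun v => by simp [input, toArray]
  constructor
  · simp [hs, Prog.flat, hreg, hn]
  · simp [hs, Prog.flat, hreg, input]
  · simp [hs, Prog.flat, NatExpr.eval]
  · intro v
    rw [eA, hpar, input_parent]
  · intro v
    rw [eR, hreal 0 (by norm_num), hlen]
  · intro i
    rw [eA, hmark]
    rfl
  · intro u hu
    rw [eA, hptr u hu]
    exact hu
  · simp
  · simp
  · intro v _
    rw [eA, hpend]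
    congr 1
    ext c
    simp
  · simp
  · simp
  · intro v _
    rw [Finset.singleton_subset_iff]
    exact T.self_mem_subtree v
  · intro v _ u hu huv
    exact absurd (Finset.mem_singleton.1 hu) huv
  · simp
  · intro v _ w _ hvw
    exact Finset.disjoint_singleton.2 hvw
  · intro v _
    have hK : s.realArr 1 v = T.prize v := by rw [eR, hreal 1 (by norm_num), hprize]
    have hI : s.realArr 2 v = 1 - T.prob v := by rw [eR, hidle v v.2, hpr]
    have hL : s.natArr 3 v = v := by rw [eA, hlow v v.2]
    have hH : s.natArr 4 v = if T.prize v < 0 then (v : ℕ) else v + 1 := by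
      rw [eA, hhigh v v.2, hprize]
    have hcl : cluster n (s.natArr 6) v = {v} := by
      ext u
      rw [mem_cluster, Finset.mem_singleton]
      have hu : s.natArr 6 u = u := by rw [eA, hptr u u.2]
      simp only [Function.iterate_fixed hu, exists_const]
      exact Fin.ext_iff.symm
    have hseg : reps s v = if T.prize v < 0 then [] else [(v : ℕ)] := by
      rw [reps, hL, hH]
      split_ifs
      · exact seg_self
      · rw [seg_succ le_rfl, seg_self, eA, hmem v v.2]
    have := v.2
    refine ⟨?_, ?_, ?_, ?_, ?_, ?_, ?_⟩
    · rw [hL, hH]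
      split_ifs <;> omega
    · rw [hH, e4]
      split_ifs <;> omega
    all_goals rw [hseg]
    · split_ifs <;> simp [eA, hptr v v.2]
    · split_ifs <;> simp
    · split_ifs <;> simp
    · split_ifs <;> simp
    · rw [Finset.erase_singleton]
      split_ifs with h
      · exact T.represents_nil h
      · have := T.represents_singleton (not_lt.1 h)
        simpa [block, hK, hI, hcl] using this

/-- Mark the representatives of the blocks of the root. -/
def mark : Prog :=
  .seq (.setNat 5 (.get 3 (.reg 1))) (.loop (.natLt (.reg 5) (.get 4 (.reg 1)))
    (.seq (.putNat 7 (.get 5 (.reg 5)) (.const 1)) (.setNat 5 (.add (.reg 5) (.const 1)))))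

theorem mark_within {n : ℕ} {s : State} {r : ℕ} (hr : s.natReg 1 = r)
    (hle : s.natArr 3 r ≤ s.natArr 4 r) (hlen : s.natArr 4 r - s.natArr 3 r ≤ n)
    (h7 : ∀ i, s.natArr 7 i = 0) :
    Within mark s (30 * n + 20) fun s' => s'.natReg 0 = s.natReg 0 ∧ s'.natArr 6 = s.natArr 6 ∧
      ∀ x, s'.natArr 7 x = 1 ↔ x ∈ reps s r := by
  refine (Within.flat_seq (by simp [Prog.Flat]) (Within.flat_loop (by simp [Prog.Flat])
    (fun m s' => s'.natReg 0 = s.natReg 0 ∧ s'.natReg 1 = r ∧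
      (∀ a, a ≠ 7 → s'.natArr a = s.natArr a) ∧
      s.natArr 3 r ≤ s'.natReg 5 ∧ s'.natReg 5 ≤ s.natArr 4 r ∧ m = s.natArr 4 r - s'.natReg 5 ∧
      ∀ x, s'.natArr 7 x = 1 ↔ x ∈ seg (s.natArr 5) (s.natArr 3 r) (s'.natReg 5)) ?_
    (m := s.natArr 4 r - s.natArr 3 r) ?_)).mono ?_ ?_
  · rintro m s' ⟨h0, h1, hA, hlo, hhi, rfl, hx⟩ hb
    have hi : s'.natReg 5 < s.natArr 4 r := by
      simpa [Test.Holds, NatExpr.eval, h1, hA] using hb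
    refine ⟨s.natArr 4 r - (s'.natReg 5 + 1), by omega, ?_, ?_, ?_, ?_, ?_, ?_, ?_⟩
    · simp [Prog.flat, h0]
    · simp [Prog.flat, h1]
    · intro a ha
      simp [Prog.flat, ha, hA]
    · simp only [Prog.flat, NatExpr.eval, State.setNat_natReg, Function.update_self,
        State.putNat_natReg]
      omega
    · simp only [Prog.flat, NatExpr.eval, State.setNat_natReg, Function.update_self,
        State.putNat_natReg]
      omega
    · simp [Prog.flat, NatExpr.eval]
    · intro x
      have e : (Prog.flat (.seq (.putNat 7 (.get 5 (.reg 5)) (.const 1))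
          (.setNat 5 (.add (.reg 5) (.const 1)))) s').natReg 5 = s'.natReg 5 + 1 := by
        simp [Prog.flat, NatExpr.eval]
      rw [e, seg_succ hlo, List.mem_cons, ← hx]
      simp only [Prog.flat, NatExpr.eval, State.setNat_natArr, State.putNat_natArr,
        Function.update_self, hA 5 (by norm_num), Function.update_apply]
      by_cases hxa : x = s.natArr 5 (s'.natReg 5) <;> simp [hxa]
  · refine ⟨?_, ?_, ?_, ?_, ?_, ?_, ?_⟩
    all_goals simp [Prog.flat, NatExpr.eval, hr, hle, h7]
  · simp only [Test.cost, NatExpr.cost, Prog.flatCost]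
    omega
  · rintro s' ⟨⟨m, h0, h1, hA, hlo, hhi, -, hx⟩, hb⟩
    have hi : s'.natReg 5 = s.natArr 4 r := by
      refine le_antisymm hhi ?_
      simpa [Test.Holds, NatExpr.eval, h1, hA] using hb
    rw [hi] at hx
    exact ⟨h0, hA 6 (by norm_num), hx⟩

/-- Follow the pointers from node `v`, as often as there are nodes. -/
def follow : Prog :=
  .seq (.seq (.setNat 5 (.reg 3)) (.setNat 6 (.const 0)))
    (.loop (.natLt (.reg 6) (.reg 0))
      (.seq (.setNat 5 (.get 6 (.reg 5))) (.setNat 6 (.add (.reg 6) (.const 1)))))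

theorem follow_within {n : ℕ} {s : State} (hn : s.natReg 0 = n) :
    Within follow s (20 * n + 20) fun s' => s'.natReg 0 = n ∧ s'.natReg 3 = s.natReg 3 ∧
      s'.natArr = s.natArr ∧ s'.natReg 5 = (s.natArr 6)^[n] (s.natReg 3) := by
  refine (Within.flat_seq (by simp [Prog.Flat]) (Within.flat_loop (by simp [Prog.Flat])
    (fun m s' => s'.natReg 0 = n ∧ s'.natReg 3 = s.natReg 3 ∧ s'.natArr = s.natArr ∧
      s'.natReg 6 ≤ n ∧ m = n - s'.natReg 6 ∧
      s'.natReg 5 = (s.natArr 6)^[s'.natReg 6] (s.natReg 3)) ?_ (m := n) ?_)).mono ?_ ?_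
  · rintro m s' ⟨h0, h3, hA, h6, rfl, h5⟩ hb
    have hi : s'.natReg 6 < n := by
      simpa [Test.Holds, NatExpr.eval, h0] using hb
    refine ⟨n - (s'.natReg 6 + 1), by omega, ?_⟩
    simp only [Prog.flat, NatExpr.eval, State.setNat_natReg, State.setNat_natArr, hA, h5,
      Function.update_apply]
    simp [h0, h3, Nat.succ_le_of_lt hi, Function.iterate_succ_apply']
  · simp [Prog.flat, NatExpr.eval, hn]
  · simp only [Test.cost, NatExpr.cost, Prog.flatCost]
    omega
  · rintro s' ⟨⟨m, h0, h3, hA, h6, -, h5⟩, hb⟩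
    have hi : s'.natReg 6 = n := by
      refine le_antisymm h6 ?_
      simpa [Test.Holds, NatExpr.eval, h0] using hb
    rw [hi] at h5
    exact ⟨h0, h3, hA, h5⟩

/-- Output the nodes whose block is marked. -/
def resolve : Prog :=
  .seq (.setNat 3 (.const 0)) (.loop (.natLt (.reg 3) (.reg 0)) (.seq follow
    (.seq (.putNat 1 (.reg 3) (.get 7 (.reg 5))) (.setNat 3 (.add (.reg 3) (.const 1))))))

/-- Each node takes a walk of exactly `n` pointer steps; no path compression is needed for a
quadratic bound. -/
theorem resolve_within {n : ℕ} {s : State} (hn : s.natReg 0 = n) :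
    Within resolve s (n * (20 * n + 40) + 10) fun s' =>
      ∀ v < n, s'.natArr 1 v = s.natArr 7 ((s.natArr 6)^[n] v) := by
  refine (Within.flat_seq (by simp [Prog.Flat]) (Within.loop (c := 20 * n + 20 + 8)
    (fun m s' => s'.natReg 0 = n ∧ s'.natReg 3 ≤ n ∧ m = n - s'.natReg 3 ∧
      s'.natArr 6 = s.natArr 6 ∧ s'.natArr 7 = s.natArr 7 ∧
      ∀ v < s'.natReg 3, s'.natArr 1 v = s.natArr 7 ((s.natArr 6)^[n] v)) ?_ (m := n) ?_)).mono
      ?_ ?_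
  · rintro m s' ⟨h0, h3, rfl, h6, h7, hx⟩ hb
    have hi : s'.natReg 3 < n := by
      simpa [Test.Holds, NatExpr.eval, h0] using hb
    refine Within.seq ((follow_within h0).mono le_rfl ?_)
    rintro s₁ ⟨g0, g3, gA, g5⟩
    refine Within.flat (by simp [Prog.Flat]) ⟨n - (s'.natReg 3 + 1), by omega, ?_⟩
    simp only [Prog.flat, NatExpr.eval, State.setNat_natReg, State.setNat_natArr,
      State.putNat_natReg, State.putNat_natArr, gA, g3, g5, Function.update_apply]
    refine ⟨by simp [g0], by simpa using hi, by simp, by simp [h6], by simp [h7], ?_⟩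
    intro v hv
    simp only [↓reduceIte] at hv ⊢
    rw [Function.update_apply]
    split_ifs with hvi
    · rw [h6, h7, hvi]
    · exact hx v (by omega)
  · simp [Prog.flat, NatExpr.eval, hn]
  · simp only [Test.cost, NatExpr.cost, Prog.flatCost]
    nlinarith
  · rintro s' ⟨⟨m, h0, h3, -, -, -, hx⟩, hb⟩
    have hi : s'.natReg 3 = n := by
      refine le_antisymm h3 ?_
      simpa [Test.Holds, NatExpr.eval, h0] using hb
    rwa [hi] at hx

/-- A program that solves the probabilistic profitable tour problem on a tree. -/
def solve : Prog :=
  .seq init (.seq (.loop (.natLt (.reg 2) (.reg 0)) round) (.seq mark resolve))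

/-- Register `2` is one more than the number of processed nodes, so the loop stops after `n - 1`
rounds with a single node left. -/
theorem rounds_within {n : ℕ} {T : PPTPT n} {U : Fin n → Finset (Fin n)} {s : State}
    (h : Progress T ∅ U s) (hn : 1 ≤ n) :
    Within (.loop (.natLt (.reg 2) (.reg 0)) round) s (n * (roundCost * n + 4) + 4) fun s' =>
      ∃ D U', D.card + 1 = n ∧ Progress T D U' s' := by
  refine (Within.loop (c := roundCost * n) (fun m s' => ∃ D U', D.card + 1 ≤ n ∧
    m = n - (D.card + 1) ∧ Progress T D U' s') ?_ (m := n - 1)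
    ⟨∅, U, by simpa using hn, by simp, h⟩).mono ?_ ?_
  · rintro m s' ⟨D, U', h1, rfl, hp⟩ hb
    have hD : D.card + 1 < n := by
      simpa [Test.Holds, NatExpr.eval, hp.nodes_eq, hp.round_eq] using hb
    refine (round_within hp hD).mono le_rfl ?_
    rintro s₁ ⟨D', U₁, h2, h3⟩
    exact ⟨n - (D'.card + 1), by omega, D', U₁, by omega, rfl, h3⟩
  · simp only [Test.cost, NatExpr.cost]
    have : (n - 1) * (1 + 1 + 1 + roundCost * n + 1) ≤ n * (roundCost * n + 4) := by
      refine Nat.mul_le_mul (Nat.sub_le _ _) (by omega)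
    omega
  · rintro s' ⟨⟨m, D, U', h1, -, hp⟩, hb⟩
    refine ⟨D, U', le_antisymm h1 ?_, hp⟩
    simpa [Test.Holds, NatExpr.eval, hp.nodes_eq, hp.round_eq] using hb

/-- When only the root is left, the blocks of its list form an optimal set. -/
theorem Progress.isOptimalSet {n : ℕ} {T : PPTPT n} {D : Finset (Fin n)}
    {U : Fin n → Finset (Fin n)} {s : State} (h : Progress T D U s) (hD : D.card + 1 = n) :
    T.IsOptimalSet (Block.union ((reps s T.root).map (block n s))) := by
  classical
  have hall : ∀ c, c ≠ T.root → c ∈ D := by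
    intro c hc
    have h1 : D ⊆ Finset.univ.erase T.root := fun d hd =>
      Finset.mem_erase.2 ⟨by rintro rfl; exact h.root_notMem hd, Finset.mem_univ _⟩
    have h2 : D = Finset.univ.erase T.root := by
      refine Finset.eq_of_subset_of_card_le h1 ?_
      rw [Finset.card_erase_of_mem (Finset.mem_univ _), Finset.card_univ, Fintype.card_fin]
      omega
    rw [h2]
    exact Finset.mem_erase.2 ⟨hc, Finset.mem_univ _⟩
  have hU : U T.root = Finset.univ := by
    rw [h.eq_subtree h.root_notMem fun c _ hc => hall c hc, subtree_root]
  have := (h.stores T.root h.root_notMem).represents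
  rw [hU] at this
  exact T.isOptimalSet_union this

/-- A node is output when the end of its pointer path is marked, which by `mem_cluster_iff_iterate`
means that it lies in a block of the root's list. -/
theorem solve_within {n : ℕ} (T : PPTPT n) :
    Within solve T.input ((initBody.flatCost + roundCost + 200) * n ^ 2) fun s =>
      T.IsOptimalSet (output n s) := by
  have hn : 1 ≤ n := by have := T.root.2; omega
  refine (Within.seq ((init_within T).mono le_rfl fun s₁ h₁ =>
    Within.seq ((rounds_within h₁ hn).mono le_rfl ?_))).mono
    (t := (initBody.flatCost + 5) * n + 10 + (n * (roundCost * n + 4) + 4 +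
      (30 * n + 20 + (n * (20 * n + 40) + 10)))) ?_ fun _ h => h
  · rintro s₂ ⟨D, U, hD, hp⟩
    have hst := hp.stores T.root hp.root_notMem
    have hlen := length_le_of_nodup hst.nodup hst.lt
    rw [reps, length_seg] at hlen
    refine Within.seq ((mark_within hp.root_eq hst.lo_le hlen hp.unmarked).mono le_rfl ?_)
    rintro s₃ ⟨h0, h6, h7⟩
    refine (resolve_within (h0.trans hp.nodes_eq)).mono le_rfl fun s₄ h4 => ?_
    have : output n s₄ = Block.union ((reps s₂ T.root).map (block n s₂)) := by
      ext v
      rw [output, Finset.mem_filter, h4 v v.2, h7, Block.mem_union, h6]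
      simp only [Finset.mem_univ, true_and, List.mem_map, exists_exists_and_eq_and]
      constructor
      · intro hv
        exact ⟨_, hv, (mem_cluster_iff_iterate hp.ptr_lt (hst.fixed _ hv)).2 rfl⟩
      · rintro ⟨c, hc, hv⟩
        rwa [(mem_cluster_iff_iterate hp.ptr_lt (hst.fixed c hc)).1 hv]
    rw [this]
    exact hp.isOptimalSet hD
  -- The purely numerical terms are `20 n ^ 2 + 79 n + 44`, covered by `200 n ^ 2` since `n ≥ 1`;
  -- the symbolic linear term needs `n ≤ n ^ 2`.
  · nlinarith [Nat.zero_le (initBody.flatCost), Nat.zero_le roundCost,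
      Nat.mul_le_mul_left initBody.flatCost (Nat.le_self_pow (n := 2) (by norm_num) n)]

end RealRAM

theorem theorem1 :
    ∃ (P : RealRAM.Prog) (C : ℕ), ∀ (n : ℕ) (T : PPTPT n),
      ∃ (s : RealRAM.State) (t : ℕ), RealRAM.Exec P T.input s t ∧ t ≤ C * n ^ 2 ∧
        T.IsOptimalSet (PPTPT.output n s) := by
  exact ⟨RealRAM.solve, RealRAM.initBody.flatCost + RealRAM.roundCost + 200,
    fun n T => RealRAM.solve_within T⟩
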